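/- Let $\overline{\mathbb D}$ and $\mathbb T$ be the closed unit disc and the unit circle in $\mathbb C$. For each $n\ge 1$ place $n$ equally spaced points (in any position) on the circle of radius $1+1/n$ about $0$; let $U$ be the set of all these points, and put $K=\overline{\mathbb D}\cup U$ and $L=\mathbb T\cup U$. Then $K$ is compact, $U$ is countably infinite and is exactly the set of isolated points of $K$, and $\overline U=L$. Let $M_0=1$ and $M_k=k!\,\log 2\,\log 3\cdots\log(k+2)$ for $k\ge 1$. Let $B$ be the set of all functions $g$ on $\overline{\mathbb D}$ that are infinitely differentiable (in the complex sense, relative to $\overline{\mathbb D}$) with $\|g\|_B=\sum_{k\ge0}\frac1{M_k}\sup_{\overline{\mathbb D}}|g^{(k)}|<\infty$. Let $C$ be the set of all Lipschitz functions $h$ on $L$, with $\|h\|_C=\sup_L|h|+\sup\{|h(z)-h(w)|/|z-w|: z,w\in L,\ z\ne w\}$. Let $A$ be the set of all $f\in C(K)$ with $f|\overline{\mathbb D}\in B$ and $f|L\in C$, with $\|f\|_A=\max\{\|f|\overline{\mathbb D}\|_B,\|f|L\|_C\}$. Let $\mathfrak A$ be the set of all $f\in A$ such that $$\lim_{n\to\infty}\frac{f(x_n)-f(z_0)}{x_n-z_0}=(f|\overline{\mathbb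 D})'(z_0)$$ whenever $z_0\in\mathbb T$ and $(x_n)$ is a sequence in $U$ with $x_n\to z_0$. Recall that a Banach function algebra on a non-empty compact space $X$ is a unital subalgebra of $C(X)$ that separates the points of $X$ and is a unital Banach algebra for some norm; it is natural if each of its characters is the evaluation at a point of $X$. A closed set $F\subset X$ is a peak set of it if it contains some $f$ with $|f|=1$ on $F$ and $|f|<1$ on $X\setminus F$; a point $x$ is a strong boundary point if $\{x\}$ is an intersection of peak sets; and $M_x$ denotes the maximal ideal of the functions that vanish at $x$. Then $(\mathfrak A,\|\cdot\|_A)$ is a natural, infinite-dimensional Banach function algebra on $K$, its set of strong boundary points is exactly $U$, and for each $x\in U$ the maximal ideal $M_x$ of $\mathfrak A$ is singly generated. Consequently, the following assertion is false: every natural Banach function algebra $A$ on a compact space such that the set of strong boundary points of $A$ is countable and $M_x$ is countably generated for each strong boundary point $x$ is finite dimensional. -/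

import Mathlib

open scoped Topology ContDiff

namespace BFA

noncomputable section

/-! Banach function algebras on a compact space, their characters and strong boundary points. -/

/-- `A` is a Banach function algebra on the non-empty compact Hausdorff space `X`, for the norm
`N`: a unital subalgebra of `C(X)` that separates the points of `X` and is a unital Banach algebra
for `N` (`AlgebraNorm` says that `N` is a submultiplicative norm). -/
structure IsBanachFunctionAlgebra {X : Type*} [TopologicalSpace X]
    (A : Subalgebra ℂ C(X, ℂ)) (N : AlgebraNorm ℂ A) : Prop where
  compactSpace : CompactSpace X
  t2Space : T2Space X
  nonempty : Nonempty X
  separatesPoints : ∀ x y : X, x ≠ y → ∃ f ∈ A, f x ≠ f y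
  norm_one : N 1 = 1
  complete : ∀ u : ℕ → A,
    (∀ ε : ℝ, 0 < ε → ∃ n₀ : ℕ, ∀ m ≥ n₀, ∀ n ≥ n₀, N (u m - u n) < ε) →
      ∃ f : A, Filter.Tendsto (fun n => N (u n - f)) Filter.atTop (𝓝 0)

/-- Every character of `A` is the evaluation at a point of `X`. -/
def IsNatural {X : Type*} [TopologicalSpace X] (A : Subalgebra ℂ C(X, ℂ)) : Prop :=
  ∀ φ : A →ₐ[ℂ] ℂ, ∃ x : X, ∀ f : A, φ f = (f : C(X, ℂ)) x

/-- Peak sets of `A`. -/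
def IsPeakSet {X : Type*} [TopologicalSpace X] (A : Subalgebra ℂ C(X, ℂ)) (F : Set X) : Prop :=
  IsClosed F ∧ ∃ f ∈ A, (∀ x ∈ F, ‖f x‖ = 1) ∧ ∀ y ∉ F, ‖f y‖ < 1

/-- The set `S₀(A)` of strong boundary points: the points `x` such that `{x}` is an intersection
of peak sets. -/
def strongBoundary {X : Type*} [TopologicalSpace X] (A : Subalgebra ℂ C(X, ℂ)) : Set X :=
  {x | ∃ 𝓕 : Set (Set X), (∀ F ∈ 𝓕, IsPeakSet A F) ∧ ⋂₀ 𝓕 = {x}}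

/-- The maximal ideal `M_x = {f ∈ A : f x = 0}`. -/
def maxIdealAt {X : Type*} [TopologicalSpace X] (A : Subalgebra ℂ C(X, ℂ)) (x : X) : Ideal A where
  carrier := {f | (f : C(X, ℂ)) x = 0}
  add_mem' := by
    intro f g hf hg
    simp only [Set.mem_ofPred_eq] at hf hg ⊢
    simp [hf, hg]
  zero_mem' := by simp
  smul_mem' := by
    intro c f hf
    simp only [Set.mem_ofPred_eq] at hf ⊢
    simp [hf]

/-! The planar sets. -/

/-- The closed unit disc. -/
def disc : Set ℂ := Metric.closedBall 0 1

/-- The unit circle. -/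
def circ : Set ℂ := Metric.sphere 0 1

/-- For each `n ≥ 1`, `n` equally spaced points on the circle of radius `1 + 1/n`; the position
of the `n`-th configuration on its circle is an arbitrary angle `θ n`. -/
def U (θ : ℕ → ℝ) : Set ℂ :=
  {z | ∃ n : ℕ, 1 ≤ n ∧ ∃ j : ℕ, j < n ∧
    z = ((1 + 1 / (n : ℝ) : ℝ) : ℂ) *
      Complex.exp (((θ n + 2 * Real.pi * (j : ℝ) / (n : ℝ) : ℝ) : ℂ) * Complex.I)}

def K (θ : ℕ → ℝ) : Set ℂ := disc ∪ U θ

def L (θ : ℕ → ℝ) : Set ℂ := circ ∪ U θ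

/-! The algebra `B` of infinitely differentiable functions on the closed disc. All derivatives are
complex derivatives taken relative to the closed disc. -/

/-- `M 0 = 1` and `M k = k! * log 2 * log 3 * ⋯ * log (k + 2)` for `k ≥ 1`. -/
def M (k : ℕ) : ℝ :=
  if k = 0 then 1 else (k.factorial : ℝ) * ∏ i ∈ Finset.Icc 2 (k + 2), Real.log (i : ℝ)

/-- The `k`-th term of the norm of `B`: the uniform norm of the `k`-th derivative over `M k`. -/
def termB (g : ℂ → ℂ) (k : ℕ) : ℝ :=
  (⨆ z : disc, ‖iteratedDerivWithin k g disc (z : ℂ)‖) / M k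

/-- The restriction of `g` to the closed disc belongs to `B`. -/
def MemB (g : ℂ → ℂ) : Prop := ContDiffOn ℂ ∞ g disc ∧ Summable (termB g)

def normB (g : ℂ → ℂ) : ℝ := ∑' k, termB g k

/-! The algebra `C = Lip L`. -/

/-- The restriction of `h` to `L` is a Lipschitz function. -/
def MemC (θ : ℕ → ℝ) (h : ℂ → ℂ) : Prop := ∃ c, LipschitzOnWith c h (L θ)

def normC (θ : ℕ → ℝ) (h : ℂ → ℂ) : ℝ :=
  (⨆ z : L θ, ‖h (z : ℂ)‖) +
    sSup {r : ℝ | ∃ z ∈ L θ, ∃ w ∈ L θ, z ≠ w ∧ r = ‖h z - h w‖ / ‖z - w‖}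

/-! The algebras `A` and `𝔄` on `K`. -/

open Classical in
/-- A function on `K`, extended by `0`; only its values on `K` are ever used. -/
def ext {θ : ℕ → ℝ} (f : C(K θ, ℂ)) (z : ℂ) : ℂ := if hz : z ∈ K θ then f ⟨z, hz⟩ else 0

def MemA {θ : ℕ → ℝ} (f : C(K θ, ℂ)) : Prop := MemB (ext f) ∧ MemC θ (ext f)

def normA {θ : ℕ → ℝ} (f : C(K θ, ℂ)) : ℝ := max (normB (ext f)) (normC θ (ext f))

/-- `f ∈ A`, and the difference quotients of `f` along the sequences of `U` that converge to a
point `z₀` of the circle converge to the derivative of `f` at `z₀` relative to the closed disc. -/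
def MemFrakA {θ : ℕ → ℝ} (f : C(K θ, ℂ)) : Prop :=
  MemA f ∧ ∀ z₀ ∈ circ, ∀ x : ℕ → ℂ, (∀ n, x n ∈ U θ) →
    Filter.Tendsto x Filter.atTop (𝓝 z₀) →
      Filter.Tendsto (fun n => (ext f (x n) - ext f z₀) / (x n - z₀)) Filter.atTop
        (𝓝 (derivWithin (ext f) disc z₀))

end

end BFA

namespace BFA

/-! ### The planar sets -/

/-! The points of `U` are isolated and lie outside the disc, so the indicator `e` of such a point
`x` is `1 - (z - x) * (z - x)⁻¹` with `0⁻¹ = 0`, and it belongs to `𝔄` (`exists_indicator`). Hence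
`x` is a peak point, and `1 - e` generates `M_x` because `f = f * (1 - e)` as soon as `f x = 0`.

No point of the disc is a strong boundary point, because the maximum of `|f|` over `K` cannot be
attained there unless `|f|` is constant on the disc (`norm_eq_one_on_disc`). Inside the disc this is
the maximum principle. Suppose instead that `|f| < 1` inside and `|f z| = 1` with `|z| = 1`. Hopf's
lemma gives `z f'(z) / f(z) = c > 0`: to first order `|f|` grows radially at rate `c`. The
derivative condition carries this growth over to `U`. By equal spacing, some point of `U` on the
circle of radius `1 + 1/m` is within angle `π/m` of `z`, so its quotient by `z` has real part `1 +
1/m + o(1/m)` (`exists_seq_approach`), and there `|f|` would exceed `1`. So a peak set that meets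
the disc contains it.

Naturality: let `l = φ(z)` for a character `φ`. If `l` is off the disc, the indicator of `l` has
`φ`-value `1`, which puts `l` in `K` and makes `φ` the evaluation at `l`. If `l` is in the disc,
powers of `f` have Lipschitz constants growing like `n q ^ (n - 1)`, so the spectral radius sees
only `normB` and the uniform norm on `L`; cutting off finitely many points of `U` leaves `|φ f| ≤
normB f` (`norm_character_le_normB`). Polynomials are dense in `B`, so `φ` is again an evaluation.

The weights enter twice: the inequality `choose_mul_M_mul_M_le` makes `normB` submultiplicative, and
`M k / k!` outgrows every geometric sequence, so functions holomorphic near the disc lie in `B`.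
Completeness of `𝔄` holds because `normB` controls the derivative on the circle and `normC` the
difference quotients. -/

lemma countable_U (θ : ℕ → ℝ) : (U θ).Countable := by
  refine (Set.countable_range fun p : ℕ × ℕ => ((1 + 1 / (p.1 : ℝ) : ℝ) : ℂ) *
    Complex.exp (((θ p.1 + 2 * Real.pi * (p.2 : ℝ) / (p.1 : ℝ) : ℝ) : ℂ) * Complex.I)).mono ?_
  rintro z ⟨n, -, j, -, rfl⟩
  exact ⟨(n, j), rfl⟩

lemma norm_mul_exp (r t : ℝ) (hr : 0 ≤ r) :
    ‖(r : ℂ) * Complex.exp ((t : ℂ) * Complex.I)‖ = r := by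
  rw [norm_mul, Complex.norm_exp_ofReal_mul_I, mul_one, Complex.norm_real, Real.norm_of_nonneg hr]

lemma one_lt_norm_of_mem_U {θ : ℕ → ℝ} {z : ℂ} (hz : z ∈ U θ) : 1 < ‖z‖ := by
  obtain ⟨n, hn, j, -, rfl⟩ := hz
  have : (0 : ℝ) < n := by exact_mod_cast hn
  rw [norm_mul_exp _ _ (by positivity)]
  have : 0 < 1 / (n : ℝ) := by positivity
  linarith

lemma mem_disc {z : ℂ} : z ∈ disc ↔ ‖z‖ ≤ 1 := by simp [disc]

lemma mem_circ {z : ℂ} : z ∈ circ ↔ ‖z‖ = 1 := by simp [circ]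

lemma circ_subset_disc : circ ⊆ disc := Metric.sphere_subset_closedBall

lemma disc_subset_K (θ : ℕ → ℝ) : disc ⊆ K θ := Set.subset_union_left

lemma U_subset_K (θ : ℕ → ℝ) : U θ ⊆ K θ := Set.subset_union_right

lemma U_subset_L (θ : ℕ → ℝ) : U θ ⊆ L θ := Set.subset_union_right

lemma circ_subset_L (θ : ℕ → ℝ) : circ ⊆ L θ := Set.subset_union_left

lemma L_subset_K (θ : ℕ → ℝ) : L θ ⊆ K θ :=
  Set.union_subset_union_left _ circ_subset_disc

lemma notMem_disc_of_mem_U {θ : ℕ → ℝ} {z : ℂ} (hz : z ∈ U θ) : z ∉ disc := by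
  rw [mem_disc, not_le]
  exact one_lt_norm_of_mem_U hz

lemma mem_disc_or_mem_L {θ : ℕ → ℝ} {z : ℂ} (hz : z ∈ K θ) : z ∈ disc ∨ z ∈ L θ :=
  hz.imp id fun h => U_subset_L θ h

lemma mem_U_of_notMem_disc {θ : ℕ → ℝ} {z : ℂ} (hz : z ∈ K θ) (h : z ∉ disc) : z ∈ U θ :=
  hz.resolve_left h

/-- Only finitely many points of `U` lie outside a disc of radius larger than `1`. -/
lemma finite_U_inter (θ : ℕ → ℝ) {r : ℝ} (hr : 1 < r) : {z | z ∈ U θ ∧ r ≤ ‖z‖}.Finite := by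
  obtain ⟨N, hN⟩ := exists_nat_gt (1 / (r - 1))
  have hfin : (⋃ n ∈ Finset.range (N + 1), ⋃ j ∈ Finset.range n,
      ({((1 + 1 / (n : ℝ) : ℝ) : ℂ) *
        Complex.exp (((θ n + 2 * Real.pi * (j : ℝ) / (n : ℝ) : ℝ) : ℂ) * Complex.I)} :
        Set ℂ)).Finite :=
    Set.Finite.biUnion (Finset.finite_toSet _) fun n _ =>
      Set.Finite.biUnion (Finset.finite_toSet _) fun j _ => Set.finite_singleton _
  refine hfin.subset ?_
  rintro z ⟨⟨n, hn, j, hj, rfl⟩, hz⟩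
  have hn0 : (0 : ℝ) < n := by exact_mod_cast hn
  rw [norm_mul_exp _ _ (by positivity)] at hz
  have hlt : (n : ℝ) < N := by
    refine lt_of_le_of_lt ?_ hN
    rw [le_div_iff₀ (by linarith)]
    have : r - 1 ≤ 1 / n := by linarith
    calc (n : ℝ) * (r - 1) ≤ n * (1 / n) := by gcongr
      _ = 1 := by field_simp
  have hlt' : n < N := by exact_mod_cast hlt
  simp only [Set.mem_iUnion, Finset.mem_range]
  exact ⟨n, by omega, j, hj, rfl⟩

lemma norm_le_two {θ : ℕ → ℝ} {z : ℂ} (hz : z ∈ K θ) : ‖z‖ ≤ 2 := by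
  rcases hz with hz | ⟨n, hn, j, -, rfl⟩
  · linarith [mem_disc.1 hz]
  · have hn0 : (1 : ℝ) ≤ n := by exact_mod_cast hn
    rw [norm_mul_exp _ _ (by positivity)]
    have : 1 / (n : ℝ) ≤ 1 := by rw [div_le_one] <;> linarith
    linarith

/-- Removing points of `U` from `K` leaves a closed set. -/
lemma isClosed_disc_union {θ : ℕ → ℝ} {V : Set ℂ} (hV : V ⊆ U θ) : IsClosed (disc ∪ V) := by
  -- Each set of the intersection is a closed ball with finitely many points added.
  have h : disc ∪ V = ⋂ r ∈ Set.Ioi (1 : ℝ), (Metric.closedBall 0 r ∪ {z | z ∈ V ∧ r ≤ ‖z‖}) := by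
    ext z
    simp only [Set.mem_union, Set.mem_iInter, mem_disc, Metric.mem_closedBall, dist_zero_right,
      Set.mem_ofPred_eq, Set.mem_Ioi]
    constructor
    · rintro (h | h) r hr
      · left; linarith
      · rcases le_total ‖z‖ r with h' | h'
        · exact Or.inl h'
        · exact Or.inr ⟨h, h'⟩
    · intro h
      by_contra! hc
      obtain ⟨r, hr1, hr2⟩ := exists_between hc.1
      rcases h r hr1 with h' | h'
      · linarith
      · exact hc.2 h'.1
  rw [h]
  refine isClosed_biInter fun r hr => Metric.isClosed_closedBall.union (Set.Finite.isClosed ?_)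
  exact (finite_U_inter θ hr).subset fun z hz => ⟨hV hz.1, hz.2⟩

lemma isCompact_K (θ : ℕ → ℝ) : IsCompact (K θ) := by
  refine Metric.isCompact_of_isClosed_isBounded (isClosed_disc_union subset_rfl) ?_
  exact Metric.isBounded_closedBall.subset fun z hz =>
    mem_closedBall_zero_iff.2 (norm_le_two hz)

lemma isClosed_L (θ : ℕ → ℝ) : IsClosed (L θ) := by
  have h : L θ = K θ ∩ (Metric.ball 0 1)ᶜ := by
    ext z
    simp only [L, K, Set.mem_union, Set.mem_inter_iff, Set.mem_compl_iff, mem_ball_zero_iff,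
      not_lt, mem_circ, mem_disc]
    constructor
    · rintro (h | h)
      · exact ⟨Or.inl h.le, h.ge⟩
      · exact ⟨Or.inr h, (one_lt_norm_of_mem_U h).le⟩
    · rintro ⟨h | h, h'⟩
      · exact Or.inl (le_antisymm h h')
      · exact Or.inr h
  rw [h]
  exact (isCompact_K θ).isClosed.inter Metric.isOpen_ball.isClosed_compl

/-- Points off the disc are at a positive distance from the other points of `K`. -/
lemma exists_le_norm_sub (θ : ℕ → ℝ) {x : ℂ} (hx : x ∉ disc) :
    ∃ d > 0, ∀ z ∈ K θ, z ≠ x → d ≤ ‖z - x‖ := by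
  have hc : IsClosed (disc ∪ (U θ \ {x})) := isClosed_disc_union Set.sdiff_subset
  have hmem : x ∈ (disc ∪ (U θ \ {x}))ᶜ := by simp [hx]
  obtain ⟨d, hd, hball⟩ := Metric.isOpen_iff.1 hc.isOpen_compl x hmem
  refine ⟨d, hd, fun z hz hzx => ?_⟩
  by_contra! hlt
  have h1 : z ∈ Metric.ball x d := by rwa [Metric.mem_ball, dist_eq_norm]
  refine hball h1 ?_
  rcases hz with hz | hz
  · exact Or.inl hz
  · exact Or.inr ⟨hz, hzx⟩

lemma isOpen_singleton_iff {θ : ℕ → ℝ} (x : K θ) :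
    IsOpen ({x} : Set (K θ)) ↔ (x : ℂ) ∈ U θ := by
  constructor
  · intro h
    refine mem_U_of_notMem_disc x.2 fun hx => ?_
    obtain ⟨V, hV, hVx⟩ := isOpen_induced_iff.1 h
    have hnt : disc.Nontrivial := ⟨0, by simp [disc], 1, by simp [disc], by simp⟩
    have hperf := IsPreconnected.preperfect_of_nontrivial hnt
      (convex_closedBall (0 : ℂ) 1).isPreconnected
    have hacc := accPt_iff_nhds.1 (hperf x hx) V
      (hV.mem_nhds (by have : x ∈ Subtype.val ⁻¹' V := by rw [hVx]; rfl
                       exact this))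
    obtain ⟨y, ⟨hyV, hy⟩, hyx⟩ := hacc
    have : (⟨y, disc_subset_K θ hy⟩ : K θ) ∈ ({x} : Set (K θ)) := by rw [← hVx]; exact hyV
    exact hyx (congrArg Subtype.val this)
  · intro hx
    obtain ⟨d, hd, h⟩ := exists_le_norm_sub θ (notMem_disc_of_mem_U hx)
    refine Metric.isOpen_iff.2 ?_
    rintro y rfl
    refine ⟨d, hd, fun z hz => ?_⟩
    by_contra hne
    have := h z z.2 fun h' => hne (Subtype.ext h')
    rw [Metric.mem_ball, Subtype.dist_eq, dist_eq_norm] at hz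
    linarith

/-- Every point of the circle is approached by points of `U` from an asymptotically
non-tangential direction. -/
lemma exists_approach (θ : ℕ → ℝ) {z : ℂ} (hz : z ∈ circ) (n : ℕ) :
    ∃ α : ℝ, |α| ≤ Real.pi / (n + 1 : ℝ) ∧
      z * (((1 + 1 / (n + 1 : ℝ) : ℝ) : ℂ) * Complex.exp ((α : ℂ) * Complex.I)) ∈ U θ := by
  set t : ℝ := Complex.arg z with ht
  have hz' : z = Complex.exp ((t : ℂ) * Complex.I) := by
    have := Complex.norm_mul_exp_arg_mul_I z
    rw [mem_circ.1 hz] at this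
    simpa using this.symm
  set m : ℝ := (n + 1 : ℝ) with hm
  have hm0 : 0 < m := by positivity
  -- `s` is the angle of `z` measured in steps `2π/m` from the point of index `0`. Rounding it gives
  -- the nearest configuration point, off by at most half a step, `π/m`.
  set s : ℝ := (t - θ (n + 1)) * m / (2 * Real.pi) with hs
  set k : ℤ := round s with hk
  have hpi := Real.pi_pos
  refine ⟨2 * Real.pi / m * (k - s), ?_, n + 1, by omega,
    (k % ((n + 1 : ℕ) : ℤ)).toNat, ?_, ?_⟩
  · rw [abs_mul, abs_of_pos (by positivity), abs_sub_comm]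
    have := abs_sub_round s
    calc 2 * Real.pi / m * |s - k| ≤ 2 * Real.pi / m * (1 / 2) := by gcongr
      _ = Real.pi / m := by ring
  · have h1 := Int.emod_lt_of_pos k (by positivity : (0 : ℤ) < ((n + 1 : ℕ) : ℤ))
    have h2 := Int.emod_nonneg k (by positivity : ((n + 1 : ℕ) : ℤ) ≠ 0)
    omega
  · have h2 := Int.emod_nonneg k (by positivity : ((n + 1 : ℕ) : ℤ) ≠ 0)
    -- The index must lie in `[0, n]`, so `k` is reduced modulo `n + 1`; the discarded quotient
    -- counts full turns.
    have h3 : (((k % ((n + 1 : ℕ) : ℤ)).toNat : ℕ) : ℝ) =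
        k - m * ((k / ((n + 1 : ℕ) : ℤ) : ℤ) : ℝ) := by
      have h4 : (((k % ((n + 1 : ℕ) : ℤ)).toNat : ℕ) : ℤ) =
          k - ((n + 1 : ℕ) : ℤ) * (k / ((n + 1 : ℕ) : ℤ)) := by
        rw [Int.toNat_of_nonneg h2, Int.emod_def]
      have h5 := congrArg (Int.cast : ℤ → ℝ) h4
      push_cast at h5
      rw [hm]
      push_cast
      exact h5
    have hm' : (((n + 1 : ℕ) : ℝ)) = m := by rw [hm]; push_cast; rfl
    rw [h3, hm', hz', mul_left_comm, ← Complex.exp_add]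
    congr 1
    rw [Complex.exp_eq_exp_iff_exists_int]
    refine ⟨k / ((n + 1 : ℕ) : ℤ), ?_⟩
    have key : t + 2 * Real.pi / m * (k - s) =
        θ (n + 1) + 2 * Real.pi * (k - m * ((k / ((n + 1 : ℕ) : ℤ) : ℤ) : ℝ)) / m +
          ((k / ((n + 1 : ℕ) : ℤ) : ℤ) : ℝ) * (2 * Real.pi) := by
      rw [hs]
      field_simp
      ring
    have key' := congrArg (Complex.ofReal) key
    rw [Complex.ofReal_add, Complex.ofReal_add] at key'
    rw [← add_mul, key']
    push_cast
    ring

/-- The radial excess is `1/(n+1)`, while an angle of size `O(1/n)` changes the real part only to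
second order. The bound and the limit are what a first-order expansion at `z` needs to detect growth
in the radial direction. -/
lemma exists_seq_approach (θ : ℕ → ℝ) {z : ℂ} (hz : z ∈ circ) :
    ∃ x : ℕ → ℂ, (∀ n, x n ∈ U θ) ∧ Filter.Tendsto x Filter.atTop (𝓝 z) ∧
      (∃ C : ℝ, ∀ n : ℕ, (n + 1 : ℝ) * ‖x n / z - 1‖ ≤ C) ∧
      Filter.Tendsto (fun n : ℕ => (n + 1 : ℝ) * (x n / z - 1).re) Filter.atTop (𝓝 1) := by
  choose α hα hU using exists_approach θ hz
  have hz0 : z ≠ 0 := by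
    rintro rfl
    simp [mem_circ] at hz
  have hpi := Real.pi_pos
  have hv : ∀ w : ℂ, z * w / z = w := fun w => mul_div_cancel_left₀ w hz0
  have hC : ∀ n : ℕ, (n + 1 : ℝ) * ‖((1 + 1 / (n + 1 : ℝ) : ℝ) : ℂ) *
      Complex.exp ((α n : ℂ) * Complex.I) - 1‖ ≤ 1 + Real.pi := by
    intro n
    have hn : (0 : ℝ) < n + 1 := by positivity
    have h1 : ‖Complex.exp ((α n : ℂ) * Complex.I) - 1‖ ≤ Real.pi / (n + 1) := by
      have := Real.norm_exp_I_mul_ofReal_sub_one_le (x := α n)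
      rw [mul_comm] at this
      exact this.trans (hα n)
    have h2 : ((1 + 1 / (n + 1 : ℝ) : ℝ) : ℂ) * Complex.exp ((α n : ℂ) * Complex.I) - 1 =
        (Complex.exp ((α n : ℂ) * Complex.I) - 1) +
          ((1 / (n + 1 : ℝ) : ℝ) : ℂ) * Complex.exp ((α n : ℂ) * Complex.I) := by
      push_cast; ring
    rw [h2]
    calc (n + 1 : ℝ) * _ ≤ (n + 1 : ℝ) * (Real.pi / (n + 1) + 1 / (n + 1)) := by
          gcongr
          refine (norm_add_le _ _).trans (add_le_add h1 ?_)
          rw [norm_mul_exp _ _ (by positivity)]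
      _ = 1 + Real.pi := by field_simp; ring
  have hlim0 : Filter.Tendsto (fun n : ℕ => 1 / ((n : ℝ) + 1)) Filter.atTop (𝓝 0) :=
    tendsto_one_div_add_atTop_nhds_zero_nat
  refine ⟨_, hU, ?_, ⟨1 + Real.pi, fun n => ?_⟩, ?_⟩
  · rw [tendsto_iff_norm_sub_tendsto_zero]
    refine squeeze_zero (fun _ => norm_nonneg _) (fun n => ?_)
      (by simpa using hlim0.const_mul (1 + Real.pi))
    have hn : (0 : ℝ) < n + 1 := by positivity
    have := hC n
    rw [← mul_sub_one, norm_mul, mem_circ.1 hz, one_mul, ← div_eq_mul_inv, le_div_iff₀ hn, mul_comm]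
    exact this
  · rw [hv]
    exact hC n
  · simp only [hv]
    have hre : ∀ n : ℕ, (((1 + 1 / (n + 1 : ℝ) : ℝ) : ℂ) *
        Complex.exp ((α n : ℂ) * Complex.I) - 1).re =
          (1 + 1 / (n + 1 : ℝ)) * Real.cos (α n) - 1 := by
      intro n
      rw [Complex.sub_re, Complex.re_ofReal_mul, Complex.exp_ofReal_mul_I_re, Complex.one_re]
    simp_rw [hre]
    refine tendsto_of_tendsto_of_tendsto_of_le_of_le
      (g := fun n : ℕ => 1 - Real.pi ^ 2 * (1 / ((n : ℝ) + 1))) (h := fun _ => 1)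
      (by simpa using (hlim0.const_mul (Real.pi ^ 2)).const_sub 1) tendsto_const_nhds ?_ ?_
    · intro n
      have hn : (0 : ℝ) < n + 1 := by positivity
      have h1 := Real.one_sub_sq_div_two_le_cos (x := α n)
      have h2 : (α n) ^ 2 ≤ (Real.pi / (n + 1 : ℝ)) ^ 2 := sq_le_sq' (abs_le.1 (hα n)).1
        (abs_le.1 (hα n)).2
      have h3 : 1 / ((n : ℝ) + 1) ≤ 1 := by
        rw [div_le_one hn]; linarith [(Nat.cast_nonneg n : (0 : ℝ) ≤ n)]
      have h4 : 0 < 1 / ((n : ℝ) + 1) := by positivity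
      have h5 : 1 - (Real.pi / (n + 1 : ℝ)) ^ 2 / 2 ≤ Real.cos (α n) := by linarith
      calc 1 - Real.pi ^ 2 * (1 / ((n : ℝ) + 1))
          ≤ 1 - Real.pi ^ 2 * (1 / ((n : ℝ) + 1)) * ((1 + 1 / ((n : ℝ) + 1)) / 2) := by
            have : Real.pi ^ 2 * (1 / ((n : ℝ) + 1)) * ((1 + 1 / ((n : ℝ) + 1)) / 2) ≤
              Real.pi ^ 2 * (1 / ((n : ℝ) + 1)) := by
              apply mul_le_of_le_one_right (by positivity); linarith
            linarith
        _ = (n + 1) * ((1 + 1 / ((n : ℝ) + 1)) * (1 - (Real.pi / (n + 1 : ℝ)) ^ 2 / 2) - 1) := by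
            field_simp; ring
        _ ≤ (n + 1) * ((1 + 1 / ((n : ℝ) + 1)) * Real.cos (α n) - 1) := by gcongr
    · intro n
      have hn : (0 : ℝ) < n + 1 := by positivity
      calc (n + 1 : ℝ) * ((1 + 1 / (n + 1 : ℝ)) * Real.cos (α n) - 1)
          ≤ (n + 1 : ℝ) * ((1 + 1 / (n + 1 : ℝ)) * 1 - 1) := by
            gcongr; exact Real.cos_le_one _
        _ = 1 := by field_simp; ring

lemma closure_U (θ : ℕ → ℝ) : closure (U θ) = L θ := by
  refine subset_antisymm (closure_minimal (U_subset_L θ) (isClosed_L θ)) ?_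
  rintro z (hz | hz)
  · obtain ⟨x, hx, hlim, -⟩ := exists_seq_approach θ hz
    exact mem_closure_of_tendsto hlim (Filter.Eventually.of_forall hx)
  · exact subset_closure hz

lemma infinite_U (θ : ℕ → ℝ) : (U θ).Infinite := by
  intro hfin
  have h := closure_U θ
  rw [hfin.isClosed.closure_eq] at h
  have h1 : (1 : ℂ) ∈ U θ := by
    rw [h]
    exact circ_subset_L θ (by simp [mem_circ])
  have := one_lt_norm_of_mem_U h1
  simp at this

/-! ### The weights -/

lemma M_zero : M 0 = 1 := by simp [M]

/-- Splitting off `log 2` leaves exactly `k` logarithms, so that products over `i + j` factors can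
be split and consecutive weights compared. -/
lemma M_of_ne_zero {k : ℕ} (hk : k ≠ 0) :
    M k = k.factorial * (Real.log 2 * ∏ i ∈ Finset.range k, Real.log (i + 3)) := by
  have h : Finset.Icc 2 (k + 2) = Finset.Ico 2 (k + 3) := by
    ext i
    simp only [Finset.mem_Icc, Finset.mem_Ico]
    omega
  rw [M, if_neg hk, h, Finset.prod_Ico_eq_prod_range, show k + 3 - 2 = k + 1 by omega,
    Finset.prod_range_succ', mul_comm (Real.log 2)]
  congr 2
  refine Finset.prod_congr rfl fun i _ => ?_
  push_cast
  ring_nf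

lemma log_add_three_pos (i : ℕ) : 0 < Real.log (i + 3) :=
  Real.log_pos (by linarith [(Nat.cast_nonneg i : (0 : ℝ) ≤ i)])

lemma M_pos (k : ℕ) : 0 < M k := by
  rcases eq_or_ne k 0 with rfl | hk
  · simp [M_zero]
  · rw [M_of_ne_zero hk]
    have := Finset.prod_pos (s := Finset.range k) fun i _ => log_add_three_pos i
    have := Real.log_pos (one_lt_two)
    positivity

/-- The factorials absorb the binomial coefficient, the logarithms only grow when shifted by `i`,
and the surplus factor `log 2` is at most `1`. This is the inequality that Leibniz's rule requires.
-/
lemma choose_mul_M_mul_M_le (i j : ℕ) : ((i + j).choose i : ℝ) * (M i * M j) ≤ M (i + j) := by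
  rcases eq_or_ne i 0 with rfl | hi
  · simp [M_zero]
  rcases eq_or_ne j 0 with rfl | hj
  · simp [M_zero]
  rw [M_of_ne_zero hi, M_of_ne_zero hj, M_of_ne_zero (by omega : i + j ≠ 0)]
  have hl0 := Real.log_pos one_lt_two
  have hl1 : Real.log 2 ≤ 1 := by linarith [Real.log_two_lt_d9]
  have hpi := Finset.prod_pos (s := Finset.range i) fun i _ => log_add_three_pos i
  have hpj := Finset.prod_pos (s := Finset.range j) fun i _ => log_add_three_pos i
  have hprod : (∏ l ∈ Finset.range i, Real.log (l + 3)) * ∏ l ∈ Finset.range j, Real.log (l + 3) ≤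
      ∏ l ∈ Finset.range (i + j), Real.log (l + 3) := by
    rw [Finset.prod_range_add]
    gcongr with l
    · exact fun l _ => (log_add_three_pos l).le
    · linarith [(Nat.cast_nonneg i : (0 : ℝ) ≤ i)]
  have hfac : ((i + j).choose i : ℝ) * (i.factorial * j.factorial) = (i + j).factorial := by
    have := Nat.add_choose_mul_factorial_mul_factorial i j
    rw [← Nat.choose_symm_add] at this
    rw [← mul_assoc]
    exact_mod_cast this
  calc _ = (((i + j).choose i : ℝ) * (i.factorial * j.factorial)) * (Real.log 2 * (Real.log 2 *
        ((∏ l ∈ Finset.range i, Real.log (l + 3)) *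
          ∏ l ∈ Finset.range j, Real.log (l + 3)))) := by ring
    _ ≤ (i + j).factorial * (Real.log 2 * (1 * ∏ l ∈ Finset.range (i + j), Real.log (l + 3))) := by
        rw [hfac]
        gcongr
    _ = _ := by rw [one_mul]

/-- The weights grow faster than those of any algebra of analytic functions. -/
lemma summable_factorial_div_M (a : ℝ) (ha : 0 < a) :
    Summable fun k : ℕ => k.factorial * a ^ k / M k := by
  refine summable_of_ratio_test_tendsto_lt_one (l := 0) zero_lt_one
    (Filter.Eventually.of_forall fun k => ?_) ?_
  · have := M_pos k
    positivity
  -- For `k ≠ 0` the ratio of consecutive terms is exactly `a / log (k + 3)`.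
  · have hlim : Filter.Tendsto (fun k : ℕ => a / Real.log (k + 3)) Filter.atTop (𝓝 0) := by
      refine Filter.Tendsto.const_div_atTop ?_ a
      refine Real.tendsto_log_atTop.comp ?_
      exact Filter.tendsto_atTop_add_const_right _ _ tendsto_natCast_atTop_atTop
    refine hlim.congr' ?_
    filter_upwards [Filter.eventually_ne_atTop 0] with k hk
    have h1 := M_pos k
    have h2 := M_pos (k + 1)
    rw [Real.norm_of_nonneg (by positivity), Real.norm_of_nonneg (by positivity)]
    rw [M_of_ne_zero hk, M_of_ne_zero (Nat.succ_ne_zero k), Finset.prod_range_succ,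
      Nat.factorial_succ]
    have h3 := Finset.prod_pos (s := Finset.range k) fun i _ => log_add_three_pos i
    have h4 := Real.log_pos one_lt_two
    have h5 := log_add_three_pos k
    push_cast
    field_simp
    ring

/-! ### Derivatives relative to the closed disc -/

lemma uniqueDiffOn_disc : UniqueDiffOn ℂ disc :=
  uniqueDiffOn_convex_of_isRCLikeNormedField (convex_closedBall _ _)
    ⟨0, by rw [disc, interior_closedBall _ one_ne_zero]; simp⟩

lemma isCompact_disc : IsCompact disc := isCompact_closedBall _ _

instance : Nonempty disc := ⟨⟨0, by simp [mem_disc]⟩⟩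

lemma hasDerivWithinAt_iteratedDerivWithin {g : ℂ → ℂ} (hg : ContDiffOn ℂ ∞ g disc) (k : ℕ)
    {z : ℂ} (hz : z ∈ disc) :
    HasDerivWithinAt (iteratedDerivWithin k g disc) (iteratedDerivWithin (k + 1) g disc z)
      disc z := by
  rw [iteratedDerivWithin_succ]
  exact (hg.differentiableOn_iteratedDerivWithin (by exact_mod_cast ENat.natCast_lt_top k)
    uniqueDiffOn_disc z hz).hasDerivWithinAt

/-- Serves to identify the derivatives of a limit function with the limits of the derivatives. -/
lemma contDiffOn_of_hasDerivWithinAt {g : ℂ → ℂ} {G : ℕ → ℂ → ℂ} (h0 : Set.EqOn g (G 0) disc)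
    (hG : ∀ k, ∀ z ∈ disc, HasDerivWithinAt (G k) (G (k + 1) z) disc z) :
    ContDiffOn ℂ ∞ g disc ∧ ∀ k, Set.EqOn (iteratedDerivWithin k g disc) (G k) disc := by
  have h : ∀ k, Set.EqOn (iteratedDerivWithin k g disc) (G k) disc := by
    intro k
    induction k with
    | zero => simpa using h0
    | succ k ih =>
      intro z hz
      rw [iteratedDerivWithin_succ, derivWithin_congr ih (ih hz)]
      exact (hG k z hz).derivWithin (uniqueDiffOn_disc z hz)
  refine ⟨contDiffOn_of_differentiableOn_deriv fun m _ => ?_, h⟩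
  exact DifferentiableOn.congr (fun z hz => (hG m z hz).differentiableWithinAt) (h m)

/-- Termwise differentiation of a sequence of functions on a convex set. -/
lemma hasDerivWithinAt_of_tendstoUniformlyOn {s : Set ℂ} (hs : Convex ℝ s) {u u' : ℕ → ℂ → ℂ}
    {f f' : ℂ → ℂ} (hu : ∀ n, ∀ z ∈ s, HasDerivWithinAt (u n) (u' n z) s z)
    (hlim : ∀ z ∈ s, Filter.Tendsto (fun n => u n z) Filter.atTop (𝓝 (f z)))
    (hunif : TendstoUniformlyOn u' f' Filter.atTop s) {z : ℂ} (hz : z ∈ s) :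
    HasDerivWithinAt f (f' z) s z := by
  rw [hasDerivWithinAt_iff_isLittleO, Asymptotics.isLittleO_iff]
  intro c hc
  obtain ⟨N, hN⟩ := Filter.eventually_atTop.1
    (Metric.tendstoUniformlyOn_iff.1 hunif (c / 5) (by positivity))
  have hN' : ∀ n ≥ N, ∀ w ∈ s, ‖f' w - u' n w‖ ≤ c / 5 := fun n hn w hw => by
    rw [← dist_eq_norm]
    exact (hN n hn w hw).le
  -- The mean value inequality for `u n - u N` has a constant independent of `n`, so it survives `n
  -- → ∞`.
  have hdiff : ∀ w ∈ s, ‖(f w - u N w) - (f z - u N z)‖ ≤ 2 * c / 5 * ‖w - z‖ := by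
    intro w hw
    refine le_of_tendsto
      (((hlim w hw).sub_const (u N w)).sub ((hlim z hz).sub_const (u N z))).norm ?_
    filter_upwards [Filter.eventually_ge_atTop N] with n hn
    refine hs.norm_image_sub_le_of_norm_hasDerivWithin_le (f := fun w => u n w - u N w)
      (f' := fun w => u' n w - u' N w) (fun y hy => (hu n y hy).sub (hu N y hy))
      (fun y hy => ?_) hz hw
    have h1 := hN' n hn y hy
    have h2 := hN' N le_rfl y hy
    calc ‖u' n y - u' N y‖ = ‖(f' y - u' N y) - (f' y - u' n y)‖ := by ring_nf
      _ ≤ _ := norm_sub_le _ _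
      _ ≤ _ := by linarith
  have hloc := Asymptotics.isLittleO_iff.1
    (hasDerivWithinAt_iff_isLittleO.1 (hu N z hz)) (show 0 < c / 5 by positivity)
  filter_upwards [hloc, self_mem_nhdsWithin] with w hw hws
  have h1 := hdiff w hws
  have h2 := hN' N le_rfl z hz
  calc ‖f w - f z - (w - z) • f' z‖
      = ‖((f w - u N w) - (f z - u N z)) + (u N w - u N z - (w - z) • u' N z) -
          (w - z) * (f' z - u' N z)‖ := by simp only [smul_eq_mul]; ring_nf
    _ ≤ ‖(f w - u N w) - (f z - u N z)‖ + ‖u N w - u N z - (w - z) • u' N z‖ +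
          ‖w - z‖ * ‖f' z - u' N z‖ := by
        rw [← norm_mul]
        exact (norm_sub_le _ _).trans (add_le_add_left (norm_add_le _ _) _)
    _ ≤ 2 * c / 5 * ‖w - z‖ + c / 5 * ‖w - z‖ + ‖w - z‖ * (c / 5) := by gcongr
    _ ≤ c * ‖w - z‖ := by nlinarith [norm_nonneg (w - z)]

/-! ### The algebra `B` -/

lemma termB_nonneg (g : ℂ → ℂ) (k : ℕ) : 0 ≤ termB g k :=
  div_nonneg (Real.iSup_nonneg fun _ => norm_nonneg _) (M_pos k).le

lemma normB_nonneg (g : ℂ → ℂ) : 0 ≤ normB g := tsum_nonneg (termB_nonneg g)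

/-- Compactness of the disc is essential here: a real supremum of an unbounded family is `0` by
convention. -/
lemma norm_iteratedDerivWithin_le {g : ℂ → ℂ} (hg : ContDiffOn ℂ ∞ g disc) (k : ℕ) {z : ℂ}
    (hz : z ∈ disc) : ‖iteratedDerivWithin k g disc z‖ ≤ termB g k * M k := by
  have hc : ContinuousOn (iteratedDerivWithin k g disc) disc :=
    hg.continuousOn_iteratedDerivWithin (by exact_mod_cast le_top) uniqueDiffOn_disc
  obtain ⟨C, hC⟩ := isCompact_disc.exists_bound_of_continuousOn hc
  rw [termB, div_mul_cancel₀ _ (M_pos k).ne']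
  refine le_ciSup (f := fun z : disc => ‖iteratedDerivWithin k g disc (z : ℂ)‖)
    ⟨C, ?_⟩ (⟨z, hz⟩ : disc)
  rintro _ ⟨w, rfl⟩
  exact hC w w.2

lemma termB_le {g : ℂ → ℂ} {k : ℕ} {c : ℝ}
    (h : ∀ z ∈ disc, ‖iteratedDerivWithin k g disc z‖ ≤ c * M k) : termB g k ≤ c := by
  rw [termB, div_le_iff₀ (M_pos k)]
  exact ciSup_le fun z => h z z.2

lemma termB_congr {g h : ℂ → ℂ} (hgh : Set.EqOn g h disc) : termB g = termB h := by
  ext k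
  simp only [termB]
  congr 1
  exact iSup_congr fun z => by rw [iteratedDerivWithin_congr hgh z.2]

lemma memB_congr {g h : ℂ → ℂ} (hgh : Set.EqOn g h disc) : MemB g ↔ MemB h := by
  rw [MemB, MemB, termB_congr hgh, contDiffOn_congr hgh]

lemma normB_congr {g h : ℂ → ℂ} (hgh : Set.EqOn g h disc) : normB g = normB h := by
  rw [normB, normB, termB_congr hgh]

lemma memB_of_termB_le {g : ℂ → ℂ} {a : ℕ → ℝ} (hg : ContDiffOn ℂ ∞ g disc) (ha : Summable a)
    (h : ∀ k, termB g k ≤ a k) : MemB g ∧ normB g ≤ ∑' k, a k := by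
  have hs : Summable (termB g) := Summable.of_nonneg_of_le (termB_nonneg g) h ha
  exact ⟨⟨hg, hs⟩, hs.tsum_le_tsum h ha⟩

lemma MemB.termB_le_normB {g : ℂ → ℂ} (hg : MemB g) (k : ℕ) : termB g k ≤ normB g :=
  hg.2.le_tsum k fun j _ => termB_nonneg g j

lemma MemB.norm_le {g : ℂ → ℂ} (hg : MemB g) {z : ℂ} (hz : z ∈ disc) : ‖g z‖ ≤ normB g := by
  have := norm_iteratedDerivWithin_le hg.1 0 hz
  rw [iteratedDerivWithin_zero, M_zero, mul_one] at this
  exact this.trans (hg.termB_le_normB 0)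

lemma contDiffWithinAt_nat {g : ℂ → ℂ} (hg : ContDiffOn ℂ ∞ g disc) (k : ℕ) {z : ℂ}
    (hz : z ∈ disc) : ContDiffWithinAt ℂ k g disc z :=
  (hg z hz).of_le (by exact_mod_cast le_top)

lemma termB_add_le {g h : ℂ → ℂ} (hg : ContDiffOn ℂ ∞ g disc) (hh : ContDiffOn ℂ ∞ h disc)
    (k : ℕ) : termB (g + h) k ≤ termB g k + termB h k := by
  refine termB_le fun z hz => ?_
  rw [iteratedDerivWithin_add hz uniqueDiffOn_disc (contDiffWithinAt_nat hg k hz)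
    (contDiffWithinAt_nat hh k hz), add_mul]
  exact (norm_add_le _ _).trans (add_le_add (norm_iteratedDerivWithin_le hg k hz)
    (norm_iteratedDerivWithin_le hh k hz))

lemma termB_const_mul (c : ℂ) (g : ℂ → ℂ) (k : ℕ) :
    termB (fun z => c * g z) k = ‖c‖ * termB g k := by
  have h (z : ℂ) : ‖iteratedDerivWithin k (fun z => c * g z) disc z‖ =
      ‖c‖ * ‖iteratedDerivWithin k g disc z‖ := by
    rw [iteratedDerivWithin_const_mul_field, norm_mul]
  simp only [termB, h]
  rw [← Real.mul_iSup_of_nonneg (norm_nonneg c), mul_div_assoc]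

lemma MemB.add {g h : ℂ → ℂ} (hg : MemB g) (hh : MemB h) :
    MemB (g + h) ∧ normB (g + h) ≤ normB g + normB h := by
  rw [normB, normB, normB, ← hg.2.tsum_add hh.2]
  exact memB_of_termB_le (hg.1.add hh.1) (hg.2.add hh.2) (termB_add_le hg.1 hh.1)

lemma MemB.const_mul (c : ℂ) {g : ℂ → ℂ} (hg : MemB g) : MemB fun z => c * g z := by
  refine ⟨contDiffOn_const.mul hg.1, ?_⟩
  simp_rw [funext (termB_const_mul c g)]
  exact hg.2.mul_left _

lemma normB_const_mul (c : ℂ) (g : ℂ → ℂ) : normB (fun z => c * g z) = ‖c‖ * normB g := by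
  simp_rw [normB, termB_const_mul, tsum_mul_left]

lemma MemB.sub {g h : ℂ → ℂ} (hg : MemB g) (hh : MemB h) :
    MemB (g - h) ∧ normB (g - h) ≤ normB g + normB h := by
  have h1 : g - h = g + fun z => (-1) * h z := by
    ext z
    simp [sub_eq_add_neg]
  have h2 := normB_const_mul (-1) h
  rw [norm_neg, norm_one, one_mul] at h2
  rw [h1, ← h2]
  exact hg.add (hh.const_mul _)

/-- Leibniz's rule, with the binomial coefficients absorbed by the weights, yields the Cauchy
product of the two series. -/
lemma termB_mul_le {g h : ℂ → ℂ} (hg : ContDiffOn ℂ ∞ g disc) (hh : ContDiffOn ℂ ∞ h disc)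
    (k : ℕ) :
    termB (g * h) k ≤ ∑ p ∈ Finset.HasAntidiagonal.antidiagonal k, termB g p.1 * termB h p.2 := by
  refine termB_le fun z hz => ?_
  rw [iteratedDerivWithin_mul hz uniqueDiffOn_disc (contDiffWithinAt_nat hg k hz)
    (contDiffWithinAt_nat hh k hz), Finset.sum_mul,
    ← Finset.Nat.sum_antidiagonal_eq_sum_range_succ fun i j =>
      (k.choose i : ℂ) * iteratedDerivWithin i g disc z * iteratedDerivWithin j h disc z]
  refine (norm_sum_le _ _).trans (Finset.sum_le_sum ?_)
  rintro ⟨i, j⟩ hij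
  rw [Finset.HasAntidiagonal.mem_antidiagonal] at hij
  subst hij
  simp only [norm_mul, Complex.norm_natCast]
  have h1 := norm_iteratedDerivWithin_le hg i hz
  have h2 := norm_iteratedDerivWithin_le hh j hz
  have h3 := mul_nonneg (termB_nonneg g i) (M_pos i).le
  calc ((i + j).choose i : ℝ) * ‖iteratedDerivWithin i g disc z‖ *
        ‖iteratedDerivWithin j h disc z‖
      ≤ ((i + j).choose i : ℝ) * (termB g i * M i) * (termB h j * M j) := by gcongr
    _ = termB g i * termB h j * (((i + j).choose i : ℝ) * (M i * M j)) := by ring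
    _ ≤ termB g i * termB h j * M (i + j) := by
        have := mul_nonneg (termB_nonneg g i) (termB_nonneg h j)
        gcongr
        exact choose_mul_M_mul_M_le i j

lemma MemB.mul {g h : ℂ → ℂ} (hg : MemB g) (hh : MemB h) :
    MemB (g * h) ∧ normB (g * h) ≤ normB g * normB h := by
  have h1 : Summable fun k => ‖termB g k‖ := hg.2.norm
  have h2 : Summable fun k => ‖termB h k‖ := hh.2.norm
  rw [normB, normB, normB, tsum_mul_tsum_eq_tsum_sum_antidiagonal_of_summable_norm h1 h2]
  exact memB_of_termB_le (hg.1.mul hh.1)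
    (summable_norm_sum_mul_antidiagonal_of_summable_norm h1 h2).of_norm
    (termB_mul_le hg.1 hh.1)

lemma memB_const (c : ℂ) : MemB (fun _ => c) ∧ normB (fun _ => c) = ‖c‖ := by
  have h : ∀ k ≠ 0, termB (fun _ => c) k = 0 := by
    intro k hk
    simp [termB, iteratedDerivWithin_const, hk]
  refine ⟨⟨contDiffOn_const, summable_of_ne_finset_zero (s := {0}) fun k hk => h k (by simpa using hk)⟩, ?_⟩
  rw [normB, tsum_eq_single 0 h]
  simp [termB, M_zero]

/-! #### Functions holomorphic on a neighbourhood of the disc -/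

/-- Cauchy's estimates in the norm of `B`. -/
lemma exists_normB_le {ρ : ℝ} (hρ : 1 < ρ) : ∃ C : ℝ, 0 ≤ C ∧ ∀ (h : ℂ → ℂ) (δ : ℝ),
    DifferentiableOn ℂ h (Metric.ball 0 ρ) → (∀ z ∈ Metric.ball (0 : ℂ) ρ, ‖h z‖ ≤ δ) →
      MemB h ∧ normB h ≤ C * δ := by
  -- A radius for which the Cauchy circles centred in the disc stay in the ball of radius `ρ`.
  set R : ℝ := (ρ - 1) / 2 with hR
  have hR0 : 0 < R := by rw [hR]; linarith
  have hs := summable_factorial_div_M R⁻¹ (by positivity)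
  refine ⟨∑' k : ℕ, k.factorial * R⁻¹ ^ k / M k, tsum_nonneg fun k => ?_, fun h δ hd hδ => ?_⟩
  · have := M_pos k
    positivity
  have hsub : ∀ z ∈ disc, Metric.closedBall z R ⊆ Metric.ball 0 ρ := by
    intro z hz w hw
    rw [mem_ball_zero_iff]
    rw [Metric.mem_closedBall, dist_eq_norm] at hw
    have := mem_disc.1 hz
    calc ‖w‖ = ‖(w - z) + z‖ := by ring_nf
      _ ≤ ‖w - z‖ + ‖z‖ := norm_add_le _ _
      _ < ρ := by linarith
  have hcd : ∀ z ∈ disc, ContDiffAt ℂ ∞ h z := fun z hz =>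
    (hd.contDiffOn Metric.isOpen_ball).contDiffAt (Metric.isOpen_ball.mem_nhds
      (hsub z hz (Metric.mem_closedBall_self hR0.le)))
  rw [← tsum_mul_right]
  refine memB_of_termB_le (fun z hz => (hcd z hz).contDiffWithinAt) (hs.mul_right δ) fun k => ?_
  refine termB_le fun z hz => ?_
  rw [iteratedDerivWithin_eq_iteratedDeriv uniqueDiffOn_disc
    ((hcd z hz).of_le (by exact_mod_cast le_top)) hz]
  have := Complex.norm_iteratedDeriv_le_of_forall_mem_sphere_norm_le k hR0
    ((hd.mono ((closure_mono Metric.ball_subset_closedBall).trans (by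
      rw [Metric.isClosed_closedBall.closure_eq]; exact hsub z hz))).diffContOnCl)
    (fun w hw => hδ w (hsub z hz (Metric.sphere_subset_closedBall hw)))
  refine this.trans (le_of_eq ?_)
  have := (M_pos k).ne'
  rw [inv_pow]
  field_simp

lemma memB_of_differentiableOn {ρ : ℝ} (hρ : 1 < ρ) {h : ℂ → ℂ}
    (hd : DifferentiableOn ℂ h (Metric.ball 0 ρ)) : MemB h := by
  obtain ⟨r, hr1, hr⟩ := exists_between hρ
  obtain ⟨C, -, hC⟩ := exists_normB_le hr1
  have hsub : Metric.closedBall (0 : ℂ) r ⊆ Metric.ball 0 ρ := Metric.closedBall_subset_ball hr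
  obtain ⟨δ, hδ⟩ := (isCompact_closedBall (0 : ℂ) r).exists_bound_of_continuousOn
    (hd.continuousOn.mono hsub)
  exact (hC h δ (hd.mono (Metric.ball_subset_closedBall.trans hsub))
    fun z hz => hδ z (Metric.ball_subset_closedBall hz)).1

/-- Taylor polynomials converge uniformly on a ball of radius `r₁ > 1`, and Cauchy's estimates turn
this into convergence in `normB`. The larger radius `r₂` is the one on which the power series is
known to converge. -/
lemma exists_polynomial_of_differentiableOn {ρ : ℝ} (hρ : 1 < ρ) {h : ℂ → ℂ}
    (hd : DifferentiableOn ℂ h (Metric.ball 0 ρ)) {ε : ℝ} (hε : 0 < ε) :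
    ∃ p : Polynomial ℂ, normB (h - fun z => p.eval z) < ε := by
  obtain ⟨r₂, hr₂1, hr₂⟩ := exists_between hρ
  obtain ⟨r₁, hr₁1, hr₁⟩ := exists_between hr₂1
  lift r₁ to NNReal using by linarith
  lift r₂ to NNReal using by linarith
  have hfp := (hd.mono (Metric.closedBall_subset_ball hr₂)).hasFPowerSeriesOnBall
    (by linarith : (0 : ℝ) < r₂)
  have hunif := hfp.tendstoUniformlyOn (r' := r₁) (by exact_mod_cast hr₁)
  obtain ⟨C, hC0, hC⟩ := exists_normB_le hr₁1
  obtain ⟨n, hn⟩ := (Metric.tendstoUniformlyOn_iff.1 hunif (ε / (2 * (C + 1)))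
    (by positivity)).exists
  set P := cauchyPowerSeries h 0 r₂ with hP
  refine ⟨∑ k ∈ Finset.range n, Polynomial.C (P.coeff k) * Polynomial.X ^ k, ?_⟩
  have hpoly : ∀ z, Polynomial.eval z (∑ k ∈ Finset.range n,
      Polynomial.C (P.coeff k) * Polynomial.X ^ k) = P.partialSum n z := by
    intro z
    rw [Polynomial.eval_finsetSum, FormalMultilinearSeries.partialSum]
    refine Finset.sum_congr rfl fun k _ => ?_
    rw [FormalMultilinearSeries.apply_eq_pow_smul_coeff]
    rw [Polynomial.eval_C_mul, Polynomial.eval_X_pow, smul_eq_mul, mul_comm]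
  have hb := (hC (h - fun z => Polynomial.eval z (∑ k ∈ Finset.range n,
    Polynomial.C (P.coeff k) * Polynomial.X ^ k)) (ε / (2 * (C + 1)))
    ((hd.mono (Metric.ball_subset_ball (by linarith))).sub
      (Polynomial.differentiable _).differentiableOn) fun z hz => by
        have := hn z hz
        rw [zero_add, dist_eq_norm] at this
        simp only [Pi.sub_apply, hpoly]
        exact this.le).2
  refine hb.trans_lt ?_
  rw [mul_div_assoc', div_lt_iff₀ (by positivity)]
  nlinarith

/-! #### Dilations and density of the polynomials -/

lemma mul_mem_disc {r : ℝ} (hr : |r| ≤ 1) {z : ℂ} (hz : z ∈ disc) : (r : ℂ) * z ∈ disc := by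
  rw [mem_disc] at *
  rw [norm_mul, Complex.norm_real, Real.norm_eq_abs]
  exact mul_le_one₀ hr (norm_nonneg _) hz

lemma iteratedDerivWithin_dilation {g : ℂ → ℂ} (hg : ContDiffOn ℂ ∞ g disc) {r : ℝ}
    (hr : |r| ≤ 1) (k : ℕ) {z : ℂ} (hz : z ∈ disc) :
    iteratedDerivWithin k (fun w => g (r * w)) disc z =
      (r : ℂ) ^ k * iteratedDerivWithin k g disc (r * z) :=
  iteratedDerivWithin_comp_const_smul hz uniqueDiffOn_disc
    (hg.of_le (by exact_mod_cast le_top)) (r : ℂ) fun _ hw => mul_mem_disc hr hw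

/-- Dominated convergence for series: each term tends to `0` by uniform continuity of the `k`-th
derivative, and is at most `2 * termB g k`. -/
lemma tendsto_normB_dilation {g : ℂ → ℂ} (hg : MemB g) {r : ℕ → ℝ} (hr : ∀ n, |r n| ≤ 1)
    (hlim : Filter.Tendsto r Filter.atTop (𝓝 1)) :
    Filter.Tendsto (fun n => normB (g - fun z => g (r n * z))) Filter.atTop (𝓝 0) := by
  have hcd : ∀ n, ContDiffOn ℂ ∞ (fun z => g (r n * z)) disc := fun n =>
    hg.1.comp (contDiff_const.mul contDiff_id).contDiffOn fun z hz => mul_mem_disc (hr n) hz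
  have hD : ∀ n k, ∀ z ∈ disc,
      iteratedDerivWithin k (g - fun z => g (r n * z)) disc z =
        iteratedDerivWithin k g disc z - (r n : ℂ) ^ k * iteratedDerivWithin k g disc (r n * z) := by
    intro n k z hz
    rw [iteratedDerivWithin_sub hz uniqueDiffOn_disc (contDiffWithinAt_nat hg.1 k hz)
      (contDiffWithinAt_nat (hcd n) k hz), iteratedDerivWithin_dilation hg.1 (hr n) k hz]
  have hbd : ∀ n k, ∀ z ∈ disc, ‖iteratedDerivWithin k g disc (r n * z)‖ ≤ termB g k * M k :=
    fun n k z hz => norm_iteratedDerivWithin_le hg.1 k (mul_mem_disc (hr n) hz)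
  have h0 : (0 : ℝ) = ∑' _ : ℕ, (0 : ℝ) := by simp
  rw [h0]
  refine tendsto_tsum_of_dominated_convergence (hg.2.mul_left 2) (fun k => ?_)
    (Filter.Eventually.of_forall fun n k => ?_)
  · rw [Metric.tendsto_atTop]
    intro ε hε
    have hMk := M_pos k
    have huc := Metric.uniformContinuousOn_iff.1
      (isCompact_disc.uniformContinuousOn_of_continuous
        (hg.1.continuousOn_iteratedDerivWithin (m := k) (by exact_mod_cast le_top)
          uniqueDiffOn_disc)) (ε * M k / 4) (by positivity)
    obtain ⟨δ, hδ, huc⟩ := huc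
    have hpow : Filter.Tendsto (fun n => ‖1 - (r n : ℂ) ^ k‖ * (termB g k * M k)) Filter.atTop
        (𝓝 0) := by
      have h1 : Filter.Tendsto (fun n => (r n : ℂ)) Filter.atTop (𝓝 (1 : ℝ)) :=
        (Complex.continuous_ofReal.tendsto 1).comp hlim
      have := (((h1.pow k).const_sub 1).norm).mul_const (termB g k * M k)
      simpa using this
    obtain ⟨N, hN⟩ := Filter.eventually_atTop.1 ((Metric.tendsto_nhds.1 hlim δ hδ).and
      (hpow.eventually (gt_mem_nhds (show 0 < ε * M k / 4 by positivity))))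
    refine ⟨N, fun n hn => ?_⟩
    obtain ⟨hn1, hn2⟩ := hN n hn
    rw [Real.dist_eq, sub_zero, abs_of_nonneg (termB_nonneg _ _)]
    refine lt_of_le_of_lt (termB_le (c := ε / 2) fun z hz => ?_) (by linarith)
    rw [hD n k z hz]
    have hdist : dist z (r n * z) < δ := by
      have h1 : z - r n * z = -((r n - 1 : ℝ) : ℂ) * z := by push_cast; ring
      rw [dist_eq_norm, h1, norm_mul, norm_neg, Complex.norm_real]
      rw [Real.dist_eq] at hn1
      have := mem_disc.1 hz
      calc ‖r n - 1‖ * ‖z‖ ≤ ‖r n - 1‖ * 1 := by gcongr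
        _ < δ := by rwa [mul_one, Real.norm_eq_abs]
    have h2 := huc z hz (r n * z) (mul_mem_disc (hr n) hz) hdist
    rw [dist_eq_norm] at h2
    have h3 := hbd n k z hz
    calc _ = ‖(iteratedDerivWithin k g disc z - iteratedDerivWithin k g disc (r n * z)) +
          (1 - (r n : ℂ) ^ k) * iteratedDerivWithin k g disc (r n * z)‖ := by ring_nf
      _ ≤ ‖iteratedDerivWithin k g disc z - iteratedDerivWithin k g disc (r n * z)‖ +
          ‖1 - (r n : ℂ) ^ k‖ * ‖iteratedDerivWithin k g disc (r n * z)‖ := by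
          rw [← norm_mul]
          exact norm_add_le _ _
      _ ≤ ε * M k / 4 + ‖1 - (r n : ℂ) ^ k‖ * (termB g k * M k) := by gcongr
      _ ≤ ε / 2 * M k := by linarith
  · rw [Real.norm_of_nonneg (termB_nonneg _ _)]
    refine termB_le fun z hz => ?_
    rw [hD n k z hz]
    have h1 : ‖(r n : ℂ) ^ k‖ ≤ 1 := by
      rw [norm_pow, Complex.norm_real]
      exact pow_le_one₀ (norm_nonneg _) (hr n)
    calc _ ≤ ‖iteratedDerivWithin k g disc z‖ +
          ‖(r n : ℂ) ^ k‖ * ‖iteratedDerivWithin k g disc (r n * z)‖ := by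
          rw [← norm_mul]
          exact norm_sub_le _ _
      _ ≤ termB g k * M k + 1 * (termB g k * M k) := by
          gcongr
          · exact norm_iteratedDerivWithin_le hg.1 k hz
          · exact hbd n k z hz
      _ = 2 * termB g k * M k := by ring

lemma memB_polynomial (p : Polynomial ℂ) : MemB fun z => p.eval z :=
  memB_of_differentiableOn one_lt_two (Polynomial.differentiable p).differentiableOn

/-- The polynomials are dense in `B`. -/
lemma exists_polynomial_normB_sub_lt {g : ℂ → ℂ} (hg : MemB g) {ε : ℝ} (hε : 0 < ε) :
    ∃ p : Polynomial ℂ, normB (g - fun z => p.eval z) < ε := by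
  set r : ℕ → ℝ := fun n => 1 - 1 / ((n : ℝ) + 1 + 1) with hr
  have hpos : ∀ n, 0 < r n := fun n => by
    have hn : (0 : ℝ) ≤ n := Nat.cast_nonneg n
    rw [hr, sub_pos, div_lt_one (by positivity)]
    linarith
  have hlt : ∀ n, r n < 1 := fun n => by
    have : 0 < 1 / ((n : ℝ) + 1 + 1) := by positivity
    simp only [hr]
    linarith
  have habs : ∀ n, |r n| ≤ 1 := fun n => by rw [abs_of_pos (hpos n)]; exact (hlt n).le
  have hlim : Filter.Tendsto r Filter.atTop (𝓝 1) := by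
    have h1 : Filter.Tendsto (fun n : ℕ => 1 / ((n : ℝ) + 1 + 1)) Filter.atTop (𝓝 0) := by
      have := (Filter.tendsto_add_atTop_iff_nat 1).2
        (tendsto_one_div_add_atTop_nhds_zero_nat (𝕜 := ℝ))
      simpa using this
    rw [← sub_zero (1 : ℝ)]
    exact h1.const_sub 1
  obtain ⟨n, hn⟩ := ((tendsto_normB_dilation hg habs hlim).eventually
    (gt_mem_nhds (show 0 < ε / 2 by positivity))).exists
  -- The dilation is holomorphic beyond the closed disc, which brings it within reach of Taylor
  -- polynomials.
  have hd : DifferentiableOn ℂ (fun z => g (r n * z)) (Metric.ball 0 (r n)⁻¹) := by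
    have h1 : DifferentiableOn ℂ g (Metric.ball 0 1) :=
      (hg.1.differentiableOn (by simp)).mono Metric.ball_subset_closedBall
    refine h1.comp (differentiableOn_const _ |>.mul differentiableOn_id) fun z hz => ?_
    rw [mem_ball_zero_iff] at *
    rw [norm_mul, Complex.norm_real, Real.norm_of_nonneg (hpos n).le]
    calc r n * ‖z‖ < r n * (r n)⁻¹ := by gcongr; exact hpos n
      _ = 1 := mul_inv_cancel₀ (hpos n).ne'
  have h1r : 1 < (r n)⁻¹ := (one_lt_inv₀ (hpos n)).2 (hlt n)
  obtain ⟨p, hp⟩ := exists_polynomial_of_differentiableOn h1r hd (half_pos hε)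
  refine ⟨p, ?_⟩
  have hdil := memB_of_differentiableOn h1r hd
  have := ((hg.sub hdil).1.add (hdil.sub (memB_polynomial p)).1).2
  rw [sub_add_sub_cancel] at this
  linarith

/-! #### Completeness -/

/-- A sequence that is Cauchy in the norm of `B` and converges pointwise converges in `B`. -/
lemma memB_of_cauchy {u : ℕ → ℂ → ℂ} {f : ℂ → ℂ} (hu : ∀ n, MemB (u n))
    (hcauchy : ∀ ε > 0, ∃ n₀ : ℕ, ∀ m ≥ n₀, ∀ n ≥ n₀, normB (u m - u n) ≤ ε)
    (hlim : ∀ z ∈ disc, Filter.Tendsto (fun n => u n z) Filter.atTop (𝓝 (f z))) :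
    MemB f ∧ ∀ ε > 0, ∃ n₀ : ℕ, ∀ n ≥ n₀, normB (u n - f) ≤ ε := by
  have hsub : ∀ m n k, ∀ z ∈ disc, iteratedDerivWithin k (u m - u n) disc z =
      iteratedDerivWithin k (u m) disc z - iteratedDerivWithin k (u n) disc z :=
    fun m n k z hz => iteratedDerivWithin_sub hz uniqueDiffOn_disc
      (contDiffWithinAt_nat (hu m).1 k hz) (contDiffWithinAt_nat (hu n).1 k hz)
  have huc : ∀ k, UniformCauchySeqOn (fun n => iteratedDerivWithin k (u n) disc)
      Filter.atTop disc := by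
    intro k
    rw [Metric.uniformCauchySeqOn_iff]
    intro ε hε
    have hMk := M_pos k
    obtain ⟨n₀, h⟩ := hcauchy (ε / (2 * M k)) (by positivity)
    refine ⟨n₀, fun m hm n hn z hz => ?_⟩
    rw [dist_eq_norm, ← hsub m n k z hz]
    have hmn := ((hu m).sub (hu n)).1
    calc _ ≤ termB (u m - u n) k * M k := norm_iteratedDerivWithin_le hmn.1 k hz
      _ ≤ ε / (2 * M k) * M k := by
          gcongr
          exact (hmn.termB_le_normB k).trans (h m hm n hn)
      _ < ε := by field_simp; linarith
  have hex : ∀ k, ∃ G : ℂ → ℂ, ∀ z ∈ disc,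
      Filter.Tendsto (fun n => iteratedDerivWithin k (u n) disc z) Filter.atTop (𝓝 (G z)) := by
    intro k
    choose! G hG using fun z (hz : z ∈ disc) =>
      cauchySeq_tendsto_of_complete ((huc k).cauchySeq hz)
    exact ⟨G, hG⟩
  choose G hG using hex
  have hGu : ∀ k, TendstoUniformlyOn (fun n => iteratedDerivWithin k (u n) disc) (G k)
      Filter.atTop disc := fun k => (huc k).tendstoUniformlyOn_of_tendsto (hG k)
  have h0 : Set.EqOn f (G 0) disc := fun z hz =>
    tendsto_nhds_unique (hlim z hz) (by simpa using hG 0 z hz)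
  obtain ⟨hcd, hfG⟩ := contDiffOn_of_hasDerivWithinAt h0 fun k z hz =>
    hasDerivWithinAt_of_tendstoUniformlyOn (convex_closedBall _ _)
      (fun n w hw => hasDerivWithinAt_iteratedDerivWithin (hu n).1 k hw) (hG k) (hGu (k + 1)) hz
  have hterm : ∀ k, Filter.Tendsto (fun n => termB (u n - f) k) Filter.atTop (𝓝 0) := by
    intro k
    rw [Metric.tendsto_atTop]
    intro ε hε
    have hMk := M_pos k
    obtain ⟨N, hN⟩ := Filter.eventually_atTop.1 (Metric.tendstoUniformlyOn_iff.1 (hGu k)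
      (ε / 2 * M k) (by positivity))
    refine ⟨N, fun n hn => ?_⟩
    rw [Real.dist_eq, sub_zero, abs_of_nonneg (termB_nonneg _ _)]
    refine lt_of_le_of_lt (termB_le (c := ε / 2) fun z hz => ?_) (by linarith)
    rw [iteratedDerivWithin_sub hz uniqueDiffOn_disc
      (contDiffWithinAt_nat (hu n).1 k hz) (contDiffWithinAt_nat hcd k hz), hfG k hz, ← dist_eq_norm,
      dist_comm]
    exact (hN n hn z hz).le
  -- Termwise limits can be taken in finite sums only; the bound is uniform in `s`, hence it passes
  -- to the whole series.
  have hsum : ∀ ε > 0, ∃ n₀ : ℕ, ∀ n ≥ n₀, ∀ s : Finset ℕ, ∑ k ∈ s, termB (u n - f) k ≤ ε := by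
    intro ε hε
    obtain ⟨n₀, h⟩ := hcauchy ε hε
    refine ⟨n₀, fun n hn s => ?_⟩
    have hlim' : Filter.Tendsto (fun m => ε + ∑ k ∈ s, termB (u m - f) k) Filter.atTop
        (𝓝 (ε + ∑ k ∈ s, 0)) := (tendsto_finsetSum s fun k _ => hterm k).const_add ε
    rw [Finset.sum_const_zero, add_zero] at hlim'
    refine ge_of_tendsto hlim' ?_
    filter_upwards [Filter.eventually_ge_atTop n₀] with m hm
    have hnm := ((hu n).sub (hu m)).1
    calc ∑ k ∈ s, termB (u n - f) k
        ≤ ∑ k ∈ s, (termB (u n - u m) k + termB (u m - f) k) := by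
          refine Finset.sum_le_sum fun k _ => ?_
          have := termB_add_le (h := u m - f) hnm.1 ((hu m).1.sub hcd) k
          rwa [sub_add_sub_cancel] at this
      _ = ∑ k ∈ s, termB (u n - u m) k + ∑ k ∈ s, termB (u m - f) k := Finset.sum_add_distrib
      _ ≤ ε + ∑ k ∈ s, termB (u m - f) k := by
          gcongr
          exact (hnm.2.sum_le_tsum s fun k _ => termB_nonneg _ k).trans (h n hn m hm)
  have hmem : MemB f := by
    obtain ⟨n, hn⟩ := hsum 1 one_pos
    have h1 : MemB (u n - f) := ⟨(hu n).1.sub hcd,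
      summable_of_sum_le (termB_nonneg _) (hn n le_rfl)⟩
    have := ((hu n).sub h1).1
    rwa [sub_sub_cancel] at this
  refine ⟨hmem, fun ε hε => ?_⟩
  obtain ⟨n₀, h⟩ := hsum ε hε
  exact ⟨n₀, fun n hn => Real.tsum_le_of_sum_le (termB_nonneg _) (h n hn)⟩

/-! ### The algebra `C` -/

/-- The uniform norm on `L`. -/
noncomputable def supC (θ : ℕ → ℝ) (h : ℂ → ℂ) : ℝ := ⨆ z : L θ, ‖h (z : ℂ)‖

/-- The least Lipschitz constant on `L`. -/
noncomputable def lipC (θ : ℕ → ℝ) (h : ℂ → ℂ) : ℝ :=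
  sSup {r : ℝ | ∃ z ∈ L θ, ∃ w ∈ L θ, z ≠ w ∧ r = ‖h z - h w‖ / ‖z - w‖}

lemma normC_eq (θ : ℕ → ℝ) (h : ℂ → ℂ) : normC θ h = supC θ h + lipC θ h := rfl

instance (θ : ℕ → ℝ) : Nonempty (L θ) := ⟨⟨1, circ_subset_L θ (by simp [mem_circ])⟩⟩

lemma supC_nonneg (θ : ℕ → ℝ) (h : ℂ → ℂ) : 0 ≤ supC θ h :=
  Real.iSup_nonneg fun _ => norm_nonneg _

lemma lipC_nonneg (θ : ℕ → ℝ) (h : ℂ → ℂ) : 0 ≤ lipC θ h := by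
  refine Real.sSup_nonneg ?_
  rintro r ⟨z, -, w, -, -, rfl⟩
  positivity

lemma normC_nonneg (θ : ℕ → ℝ) (h : ℂ → ℂ) : 0 ≤ normC θ h :=
  add_nonneg (supC_nonneg θ h) (lipC_nonneg θ h)

lemma memC_iff {θ : ℕ → ℝ} {h : ℂ → ℂ} :
    MemC θ h ↔ ∃ b : ℝ, 0 ≤ b ∧ ∀ z ∈ L θ, ∀ w ∈ L θ, ‖h z - h w‖ ≤ b * ‖z - w‖ := by
  constructor
  · rintro ⟨c, hc⟩
    refine ⟨c, c.2, fun z hz w hw => ?_⟩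
    have := hc.dist_le_mul z hz w hw
    rwa [dist_eq_norm, dist_eq_norm] at this
  · rintro ⟨b, hb, h⟩
    refine ⟨⟨b, hb⟩, LipschitzOnWith.of_dist_le_mul fun z hz w hw => ?_⟩
    rw [dist_eq_norm, dist_eq_norm]
    exact h z hz w hw

lemma MemC.continuousOn {θ : ℕ → ℝ} {h : ℂ → ℂ} (hh : MemC θ h) : ContinuousOn h (L θ) := by
  obtain ⟨c, hc⟩ := hh
  exact hc.continuousOn

lemma isCompact_L (θ : ℕ → ℝ) : IsCompact (L θ) :=
  (isCompact_K θ).of_isClosed_subset (isClosed_L θ) (L_subset_K θ)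

lemma MemC.norm_le_supC {θ : ℕ → ℝ} {h : ℂ → ℂ} (hh : MemC θ h) {z : ℂ} (hz : z ∈ L θ) :
    ‖h z‖ ≤ supC θ h := by
  obtain ⟨C, hC⟩ := (isCompact_L θ).exists_bound_of_continuousOn hh.continuousOn
  refine le_ciSup (f := fun z : L θ => ‖h z‖) ⟨C, ?_⟩ (⟨z, hz⟩ : L θ)
  rintro _ ⟨w, rfl⟩
  exact hC w w.2

lemma MemC.norm_sub_le {θ : ℕ → ℝ} {h : ℂ → ℂ} (hh : MemC θ h) {z w : ℂ} (hz : z ∈ L θ)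
    (hw : w ∈ L θ) : ‖h z - h w‖ ≤ lipC θ h * ‖z - w‖ := by
  obtain ⟨b, -, hb⟩ := memC_iff.1 hh
  rcases eq_or_ne z w with rfl | hne
  · simp
  have hpos : 0 < ‖z - w‖ := norm_pos_iff.2 (sub_ne_zero.2 hne)
  rw [← div_le_iff₀ hpos]
  refine le_csSup ⟨b, ?_⟩ ⟨z, hz, w, hw, hne, rfl⟩
  rintro _ ⟨z, hz, w, hw, hne, rfl⟩
  rw [div_le_iff₀ (norm_pos_iff.2 (sub_ne_zero.2 hne))]
  exact hb z hz w hw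

lemma supC_le {θ : ℕ → ℝ} {h : ℂ → ℂ} {a : ℝ} (ha : ∀ z ∈ L θ, ‖h z‖ ≤ a) : supC θ h ≤ a :=
  ciSup_le fun z => ha z z.2

lemma lipC_le {θ : ℕ → ℝ} {h : ℂ → ℂ} {b : ℝ} (hb : 0 ≤ b)
    (h' : ∀ z ∈ L θ, ∀ w ∈ L θ, ‖h z - h w‖ ≤ b * ‖z - w‖) : lipC θ h ≤ b := by
  refine Real.sSup_le ?_ hb
  rintro _ ⟨z, hz, w, hw, hne, rfl⟩
  rw [div_le_iff₀ (norm_pos_iff.2 (sub_ne_zero.2 hne))]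
  exact h' z hz w hw

lemma memC_congr {θ : ℕ → ℝ} {g h : ℂ → ℂ} (hgh : Set.EqOn g h (L θ)) (hg : MemC θ g) :
    MemC θ h := by
  rw [memC_iff] at *
  obtain ⟨b, hb, hg⟩ := hg
  exact ⟨b, hb, fun z hz w hw => by rw [← hgh hz, ← hgh hw]; exact hg z hz w hw⟩

lemma normC_congr {θ : ℕ → ℝ} {g h : ℂ → ℂ} (hgh : Set.EqOn g h (L θ)) :
    normC θ g = normC θ h := by
  have h1 : supC θ g = supC θ h := iSup_congr fun z => by rw [hgh z.2]
  have h2 : lipC θ g = lipC θ h := by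
    unfold lipC
    congr 1
    ext r
    constructor
    · rintro ⟨z, hz, w, hw, hne, rfl⟩
      exact ⟨z, hz, w, hw, hne, by rw [hgh hz, hgh hw]⟩
    · rintro ⟨z, hz, w, hw, hne, rfl⟩
      exact ⟨z, hz, w, hw, hne, by rw [hgh hz, hgh hw]⟩
  rw [normC_eq, normC_eq, h1, h2]

lemma memC_const (θ : ℕ → ℝ) (c : ℂ) : MemC θ (fun _ => c) ∧ normC θ (fun _ => c) = ‖c‖ := by
  have hm : MemC θ fun _ => c := memC_iff.2 ⟨0, le_rfl, fun z _ w _ => by simp⟩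
  refine ⟨hm, le_antisymm ?_ ?_⟩
  · rw [normC_eq, ← add_zero ‖c‖]
    exact add_le_add (supC_le fun _ _ => le_rfl) (lipC_le le_rfl fun z _ w _ => by simp)
  · have h1 := hm.norm_le_supC (circ_subset_L θ (show (1 : ℂ) ∈ circ by simp [mem_circ]))
    have h2 := lipC_nonneg θ fun _ => c
    rw [normC_eq]
    linarith

lemma MemC.add_lip {θ : ℕ → ℝ} {g h : ℂ → ℂ} (hg : MemC θ g) (hh : MemC θ h) {z w : ℂ}
    (hz : z ∈ L θ) (hw : w ∈ L θ) :
    ‖(g + h) z - (g + h) w‖ ≤ (lipC θ g + lipC θ h) * ‖z - w‖ := by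
  rw [Pi.add_apply, Pi.add_apply, add_sub_add_comm, add_mul]
  exact (norm_add_le _ _).trans (add_le_add (hg.norm_sub_le hz hw) (hh.norm_sub_le hz hw))

lemma MemC.add {θ : ℕ → ℝ} {g h : ℂ → ℂ} (hg : MemC θ g) (hh : MemC θ h) :
    MemC θ (g + h) ∧ normC θ (g + h) ≤ normC θ g + normC θ h := by
  have h0 := add_nonneg (lipC_nonneg θ g) (lipC_nonneg θ h)
  refine ⟨memC_iff.2 ⟨_, h0, fun z hz w hw => hg.add_lip hh hz hw⟩, ?_⟩
  have h1 : supC θ (g + h) ≤ supC θ g + supC θ h := supC_le fun z hz =>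
    (norm_add_le _ _).trans (add_le_add (hg.norm_le_supC hz) (hh.norm_le_supC hz))
  have h2 := lipC_le h0 fun z hz w hw => hg.add_lip hh hz hw
  simp only [normC_eq]
  linarith

lemma MemC.mul_lip {θ : ℕ → ℝ} {g h : ℂ → ℂ} (hg : MemC θ g) (hh : MemC θ h) {z w : ℂ}
    (hz : z ∈ L θ) (hw : w ∈ L θ) :
    ‖(g * h) z - (g * h) w‖ ≤ (supC θ g * lipC θ h + supC θ h * lipC θ g) * ‖z - w‖ := by
  have h1 := hg.norm_sub_le hz hw
  have h2 := hh.norm_sub_le hz hw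
  have h3 := hg.norm_le_supC hz
  have h4 := hh.norm_le_supC hw
  have h5 := supC_nonneg θ g
  have h6 := supC_nonneg θ h
  calc ‖(g * h) z - (g * h) w‖ = ‖g z * (h z - h w) + h w * (g z - g w)‖ := by
        simp only [Pi.mul_apply]; ring_nf
    _ ≤ ‖g z‖ * ‖h z - h w‖ + ‖h w‖ * ‖g z - g w‖ := by
        rw [← norm_mul, ← norm_mul]
        exact norm_add_le _ _
    _ ≤ supC θ g * (lipC θ h * ‖z - w‖) + supC θ h * (lipC θ g * ‖z - w‖) := by gcongr
    _ = _ := by ring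

/-- The two parts of the norm are kept apart because the spectral radius estimate must show that the
Lipschitz part does not contribute. -/
lemma MemC.mul_lipC_le {θ : ℕ → ℝ} {g h : ℂ → ℂ} (hg : MemC θ g) (hh : MemC θ h) :
    MemC θ (g * h) ∧ supC θ (g * h) ≤ supC θ g * supC θ h ∧
      lipC θ (g * h) ≤ supC θ g * lipC θ h + supC θ h * lipC θ g := by
  have h1 := supC_nonneg θ g
  have h2 := supC_nonneg θ h
  have h3 := lipC_nonneg θ g
  have h4 := lipC_nonneg θ h
  have h0 : 0 ≤ supC θ g * lipC θ h + supC θ h * lipC θ g := by positivity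
  refine ⟨memC_iff.2 ⟨_, h0, fun z hz w hw => hg.mul_lip hh hz hw⟩, ?_,
    lipC_le h0 fun z hz w hw => hg.mul_lip hh hz hw⟩
  refine supC_le fun z hz => ?_
  rw [Pi.mul_apply, norm_mul]
  exact mul_le_mul (hg.norm_le_supC hz) (hh.norm_le_supC hz) (norm_nonneg _) h1

lemma MemC.mul {θ : ℕ → ℝ} {g h : ℂ → ℂ} (hg : MemC θ g) (hh : MemC θ h) :
    MemC θ (g * h) ∧ normC θ (g * h) ≤ normC θ g * normC θ h := by
  obtain ⟨hm, h1, h2⟩ := hg.mul_lipC_le hh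
  refine ⟨hm, ?_⟩
  have h3 := mul_nonneg (lipC_nonneg θ g) (lipC_nonneg θ h)
  simp only [normC_eq]
  nlinarith

lemma normC_const_mul_le {θ : ℕ → ℝ} (c : ℂ) {h : ℂ → ℂ} (hh : MemC θ h) :
    MemC θ (fun z => c * h z) ∧ normC θ (fun z => c * h z) ≤ ‖c‖ * normC θ h := by
  have := (memC_const θ c).1.mul hh
  rwa [(memC_const θ c).2] at this

/-- A sequence that is Cauchy in the norm of `C` and converges pointwise converges in `C`. -/
lemma memC_of_cauchy {θ : ℕ → ℝ} {u : ℕ → ℂ → ℂ} {f : ℂ → ℂ} (hu : ∀ n, MemC θ (u n))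
    (hcauchy : ∀ ε > 0, ∃ n₀ : ℕ, ∀ m ≥ n₀, ∀ n ≥ n₀, normC θ (u m - u n) ≤ ε)
    (hlim : ∀ z ∈ L θ, Filter.Tendsto (fun n => u n z) Filter.atTop (𝓝 (f z))) :
    MemC θ f ∧ ∀ ε > 0, ∃ n₀ : ℕ, ∀ n ≥ n₀, normC θ (u n - f) ≤ ε := by
  have hsub : ∀ {g h : ℂ → ℂ}, MemC θ g → MemC θ h → MemC θ (g - h) := by
    intro g h hg hh
    have := (hg.add (normC_const_mul_le (-1) hh).1).1
    convert this using 1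
    ext z
    simp [sub_eq_add_neg]
  have key : ∀ ε > 0, ∃ n₀ : ℕ, ∀ n ≥ n₀, (∀ z ∈ L θ, ‖(u n - f) z‖ ≤ ε) ∧
      ∀ z ∈ L θ, ∀ w ∈ L θ, ‖(u n - f) z - (u n - f) w‖ ≤ ε * ‖z - w‖ := by
    intro ε hε
    obtain ⟨n₀, h⟩ := hcauchy ε hε
    refine ⟨n₀, fun n hn => ⟨fun z hz => ?_, fun z hz w hw => ?_⟩⟩
    · refine le_of_tendsto ((hlim z hz).const_sub (u n z)).norm ?_
      filter_upwards [Filter.eventually_ge_atTop n₀] with m hm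
      have h1 := (hsub (hu n) (hu m)).norm_le_supC hz
      have h2 := h n hn m hm
      have h3 := lipC_nonneg θ (u n - u m)
      rw [normC_eq] at h2
      exact h1.trans (by linarith)
    · refine le_of_tendsto (((hlim z hz).const_sub (u n z)).sub
        ((hlim w hw).const_sub (u n w))).norm ?_
      filter_upwards [Filter.eventually_ge_atTop n₀] with m hm
      have h1 := (hsub (hu n) (hu m)).norm_sub_le hz hw
      have h2 := h n hn m hm
      have h3 := supC_nonneg θ (u n - u m)
      rw [normC_eq] at h2
      refine h1.trans ?_
      gcongr
      linarith
  refine ⟨?_, fun ε hε => ?_⟩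
  · obtain ⟨n, hn⟩ := key 1 one_pos
    have h1 : MemC θ (u n - f) := memC_iff.2 ⟨1, zero_le_one, (hn n le_rfl).2⟩
    have := hsub (hu n) h1
    rwa [sub_sub_cancel] at this
  · obtain ⟨n₀, h⟩ := key (ε / 2) (half_pos hε)
    refine ⟨n₀, fun n hn => ?_⟩
    have h1 := supC_le (h n hn).1
    have h2 := lipC_le (half_pos hε).le (h n hn).2
    rw [normC_eq]
    linarith

/-! ### The derivative condition on the circle -/

/-- The difference quotients along `U` converge to the derivative relative to the disc. -/
def HasBdryDeriv (θ : ℕ → ℝ) (h : ℂ → ℂ) : Prop :=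
  ∀ z₀ ∈ circ, ∀ x : ℕ → ℂ, (∀ n, x n ∈ U θ) → Filter.Tendsto x Filter.atTop (𝓝 z₀) →
    Filter.Tendsto (fun n => (h (x n) - h z₀) / (x n - z₀)) Filter.atTop
      (𝓝 (derivWithin h disc z₀))

/-- The functions on the plane that represent elements of `𝔄`. -/
structure Adm (θ : ℕ → ℝ) (h : ℂ → ℂ) : Prop where
  memB : MemB h
  memC : MemC θ h
  bdry : HasBdryDeriv θ h

lemma hasBdryDeriv_congr {θ : ℕ → ℝ} {g h : ℂ → ℂ} (hgh : Set.EqOn g h (K θ))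
    (hg : HasBdryDeriv θ g) : HasBdryDeriv θ h := by
  intro z₀ hz₀ x hx hlim
  have hz := disc_subset_K θ (circ_subset_disc hz₀)
  rw [← derivWithin_congr (hgh.mono (disc_subset_K θ)) (hgh hz), ← hgh hz]
  simp_rw [fun n => (hgh (U_subset_K θ (hx n))).symm]
  exact hg z₀ hz₀ x hx hlim

lemma Adm.congr {θ : ℕ → ℝ} {g h : ℂ → ℂ} (hg : Adm θ g) (hgh : Set.EqOn g h (K θ)) :
    Adm θ h :=
  ⟨(memB_congr (hgh.mono (disc_subset_K θ))).1 hg.memB,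
    memC_congr (hgh.mono (L_subset_K θ)) hg.memC, hasBdryDeriv_congr hgh hg.bdry⟩

lemma MemB.differentiableWithinAt {g : ℂ → ℂ} (hg : MemB g) {z : ℂ} (hz : z ∈ disc) :
    DifferentiableWithinAt ℂ g disc z :=
  hg.1.differentiableOn (by simp) z hz

lemma adm_const (θ : ℕ → ℝ) (c : ℂ) : Adm θ fun _ => c :=
  ⟨(memB_const c).1, (memC_const θ c).1, fun z₀ _ x _ _ => by simp⟩

lemma Adm.add {θ : ℕ → ℝ} {g h : ℂ → ℂ} (hg : Adm θ g) (hh : Adm θ h) : Adm θ (g + h) := by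
  refine ⟨(hg.memB.add hh.memB).1, (hg.memC.add hh.memC).1, fun z₀ hz₀ x hx hlim => ?_⟩
  have hz := circ_subset_disc hz₀
  rw [derivWithin_add (hg.memB.differentiableWithinAt hz) (hh.memB.differentiableWithinAt hz)]
  refine ((hg.bdry z₀ hz₀ x hx hlim).add (hh.bdry z₀ hz₀ x hx hlim)).congr fun n => ?_
  simp only [Pi.add_apply]
  ring

lemma Adm.mul {θ : ℕ → ℝ} {g h : ℂ → ℂ} (hg : Adm θ g) (hh : Adm θ h) : Adm θ (g * h) := by
  refine ⟨(hg.memB.mul hh.memB).1, (hg.memC.mul hh.memC).1, fun z₀ hz₀ x hx hlim => ?_⟩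
  have hz := circ_subset_disc hz₀
  rw [derivWithin_mul (hg.memB.differentiableWithinAt hz) (hh.memB.differentiableWithinAt hz),
    add_comm]
  have hcont : Filter.Tendsto (fun n => g (x n)) Filter.atTop (𝓝 (g z₀)) :=
    (hg.memC.continuousOn z₀ (circ_subset_L θ hz₀)).tendsto.comp
      (tendsto_nhdsWithin_iff.2 ⟨hlim, Filter.Eventually.of_forall fun n => U_subset_L θ (hx n)⟩)
  refine ((hcont.mul (hh.bdry z₀ hz₀ x hx hlim)).add
    ((hg.bdry z₀ hz₀ x hx hlim).mul_const (h z₀))).congr fun n => ?_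
  simp only [Pi.mul_apply]
  ring

lemma norm_derivWithin_le_normB {g : ℂ → ℂ} (hg : MemB g) {z : ℂ} (hz : z ∈ disc) :
    ‖derivWithin g disc z‖ ≤ normB g * M 1 := by
  have h := norm_iteratedDerivWithin_le hg.1 1 hz
  rw [iteratedDerivWithin_one] at h
  refine h.trans ?_
  have := M_pos 1
  gcongr
  exact hg.termB_le_normB 1

/-- The condition on the derivatives is closed for the norm of `A`. -/
lemma hasBdryDeriv_of_limit {θ : ℕ → ℝ} {f : ℂ → ℂ} (hB : MemB f) (hC : MemC θ f)
    (h : ∀ ε > 0, ∃ g, Adm θ g ∧ normB (g - f) ≤ ε ∧ normC θ (g - f) ≤ ε) :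
    HasBdryDeriv θ f := by
  intro z₀ hz₀ x hx hlim
  rw [Metric.tendsto_atTop]
  intro ε hε
  have hM1 := M_pos 1
  -- The tolerance makes the error in the quotients, and the error in the derivative, which carries
  -- a factor `M 1`, both at most `ε / 4`.
  obtain ⟨g, hg, hgB, hgC⟩ := h (ε / (4 * (1 + M 1))) (by positivity)
  obtain ⟨N, hN⟩ := (Metric.tendsto_atTop.1 (hg.bdry z₀ hz₀ x hx hlim)) (ε / 4) (by positivity)
  refine ⟨N, fun n hn => ?_⟩
  have hz := circ_subset_disc hz₀
  have hε1 : ε / (4 * (1 + M 1)) ≤ ε / 4 := by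
    gcongr
    linarith
  have hε2 : ε / (4 * (1 + M 1)) * M 1 ≤ ε / 4 := by
    rw [div_mul_eq_mul_div, div_le_div_iff₀ (by positivity) (by positivity)]
    nlinarith
  have h1 : ‖derivWithin g disc z₀ - derivWithin f disc z₀‖ ≤ ε / 4 := by
    rw [← derivWithin_sub (hg.memB.differentiableWithinAt hz) (hB.differentiableWithinAt hz)]
    refine (norm_derivWithin_le_normB (hg.memB.sub hB).1 hz).trans (le_trans ?_ hε2)
    gcongr
  have hCm : MemC θ (g - f) := by
    convert (hg.memC.add (normC_const_mul_le (-1) hC).1).1 using 1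
    ext z
    simp [sub_eq_add_neg]
  have hne : x n - z₀ ≠ 0 := by
    intro h0
    have h1 := one_lt_norm_of_mem_U (hx n)
    rw [sub_eq_zero.1 h0, mem_circ.1 hz₀] at h1
    exact lt_irrefl _ h1
  have h2 : ‖(g (x n) - g z₀) / (x n - z₀) - (f (x n) - f z₀) / (x n - z₀)‖ ≤ ε / 4 := by
    rw [← sub_div, norm_div, div_le_iff₀ (norm_pos_iff.2 hne)]
    have h3 := hCm.norm_sub_le (U_subset_L θ (hx n)) (circ_subset_L θ hz₀)
    have h4 : lipC θ (g - f) ≤ ε / 4 := by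
      have := supC_nonneg θ (g - f)
      rw [normC_eq] at hgC
      linarith
    calc _ = ‖(g - f) (x n) - (g - f) z₀‖ := by simp only [Pi.sub_apply]; ring_nf
      _ ≤ _ := h3
      _ ≤ _ := by gcongr
  have h3 := hN n hn
  rw [dist_eq_norm] at h3 ⊢
  calc _ = ‖((g (x n) - g z₀) / (x n - z₀) - derivWithin g disc z₀) +
        (derivWithin g disc z₀ - derivWithin f disc z₀) -
        ((g (x n) - g z₀) / (x n - z₀) - (f (x n) - f z₀) / (x n - z₀))‖ := by ring_nf
    _ ≤ _ := norm_sub_le _ _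
    _ ≤ _ := add_le_add_left (norm_add_le _ _) _
    _ < ε := by linarith

/-! ### The algebra `𝔄` -/

lemma ext_of_mem {θ : ℕ → ℝ} (f : C(K θ, ℂ)) {z : ℂ} (hz : z ∈ K θ) : ext f z = f ⟨z, hz⟩ :=
  dif_pos hz

lemma ext_coe {θ : ℕ → ℝ} (f : C(K θ, ℂ)) (z : K θ) : ext f z = f z := ext_of_mem f z.2

lemma ext_add {θ : ℕ → ℝ} (f g : C(K θ, ℂ)) : ext (f + g) = ext f + ext g := by
  ext z
  by_cases hz : z ∈ K θ <;> simp [ext, hz]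

lemma ext_mul {θ : ℕ → ℝ} (f g : C(K θ, ℂ)) : ext (f * g) = ext f * ext g := by
  ext z
  by_cases hz : z ∈ K θ <;> simp [ext, hz]

lemma ext_sub {θ : ℕ → ℝ} (f g : C(K θ, ℂ)) : ext (f - g) = ext f - ext g := by
  ext z
  by_cases hz : z ∈ K θ <;> simp [ext, hz]

lemma ext_smul {θ : ℕ → ℝ} (c : ℂ) (f : C(K θ, ℂ)) : ext (c • f) = fun z => c * ext f z := by
  ext z
  by_cases hz : z ∈ K θ <;> simp [ext, hz]

lemma memFrakA_iff {θ : ℕ → ℝ} {f : C(K θ, ℂ)} : MemFrakA f ↔ Adm θ (ext f) :=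
  ⟨fun h => ⟨h.1.1, h.1.2, h.2⟩, fun h => ⟨⟨h.memB, h.memC⟩, h.bdry⟩⟩

instance (θ : ℕ → ℝ) : CompactSpace (K θ) := isCompact_iff_compactSpace.1 (isCompact_K θ)

/-- The algebra `𝔄`. -/
def frakA (θ : ℕ → ℝ) : Subalgebra ℂ C(K θ, ℂ) where
  carrier := {f | MemFrakA f}
  mul_mem' {f g} hf hg := by
    rw [Set.mem_ofPred_eq, memFrakA_iff] at *
    rw [ext_mul]
    exact hf.mul hg
  add_mem' {f g} hf hg := by
    rw [Set.mem_ofPred_eq, memFrakA_iff] at *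
    rw [ext_add]
    exact hf.add hg
  algebraMap_mem' c := by
    rw [Set.mem_ofPred_eq, memFrakA_iff]
    refine (adm_const θ c).congr fun z hz => ?_
    rw [ext_of_mem _ hz]
    rfl

lemma mem_frakA {θ : ℕ → ℝ} {f : C(K θ, ℂ)} : f ∈ frakA θ ↔ Adm θ (ext f) := memFrakA_iff

lemma frakA_adm {θ : ℕ → ℝ} (f : frakA θ) : Adm θ (ext (f : C(K θ, ℂ))) := mem_frakA.1 f.2

lemma norm_apply_le_normA {θ : ℕ → ℝ} {f : C(K θ, ℂ)} (hf : Adm θ (ext f)) (z : K θ) :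
    ‖f z‖ ≤ normA f := by
  rw [← ext_coe, normA]
  rcases mem_disc_or_mem_L z.2 with hz | hz
  · exact (hf.memB.norm_le hz).trans (le_max_left _ _)
  · refine ((hf.memC.norm_le_supC hz).trans ?_).trans (le_max_right _ _)
    rw [normC_eq]
    linarith [lipC_nonneg θ (ext f)]

lemma normA_nonneg {θ : ℕ → ℝ} (f : C(K θ, ℂ)) : 0 ≤ normA f :=
  (normB_nonneg _).trans (le_max_left _ _)

lemma normA_smul_le {θ : ℕ → ℝ} (c : ℂ) {f : C(K θ, ℂ)} (hf : Adm θ (ext f)) :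
    normA (c • f) ≤ ‖c‖ * normA f := by
  rw [normA, normA, ext_smul, normB_const_mul, mul_max_of_nonneg _ _ (norm_nonneg c)]
  exact max_le_max le_rfl (normC_const_mul_le c hf.memC).2

lemma normA_algebraMap {θ : ℕ → ℝ} (c : ℂ) : normA (algebraMap ℂ C(K θ, ℂ) c) = ‖c‖ := by
  have h : Set.EqOn (ext (algebraMap ℂ C(K θ, ℂ) c)) (fun _ => c) (K θ) := fun z hz => by
    rw [ext_of_mem _ hz]
    rfl
  rw [normA, normB_congr (h.mono (disc_subset_K θ)), normC_congr (h.mono (L_subset_K θ)),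
    (memB_const c).2, (memC_const θ c).2, max_self]

lemma normA_smul {θ : ℕ → ℝ} (c : ℂ) {f : C(K θ, ℂ)} (hf : Adm θ (ext f)) :
    normA (c • f) = ‖c‖ * normA f := by
  refine le_antisymm (normA_smul_le c hf) ?_
  rcases eq_or_ne c 0 with rfl | hc
  · simpa using normA_nonneg _
  have hcf : Adm θ (ext (c • f)) := by
    rw [ext_smul]
    exact (adm_const θ c).mul hf
  have := normA_smul_le c⁻¹ hcf
  rw [smul_smul, inv_mul_cancel₀ hc, one_smul, norm_inv] at this
  rwa [← le_inv_mul_iff₀ (norm_pos_iff.2 hc)]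

/-- The norm of `𝔄`. -/
noncomputable def frakNorm (θ : ℕ → ℝ) : AlgebraNorm ℂ (frakA θ) where
  toFun f := normA (f : C(K θ, ℂ))
  map_zero' := by
    have := normA_algebraMap (θ := θ) 0
    rwa [map_zero, norm_zero] at this
  add_le' f g := by
    have hB := ((frakA_adm f).memB.add (frakA_adm g).memB).2
    have hC := ((frakA_adm f).memC.add (frakA_adm g).memC).2
    rw [← ext_add] at hB hC
    exact max_le (hB.trans (add_le_add (le_max_left _ _) (le_max_left _ _)))
      (hC.trans (add_le_add (le_max_right _ _) (le_max_right _ _)))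
  neg' f := by
    have := normA_smul (-1) (frakA_adm f)
    simpa using this
  mul_le' f g := by
    have hB := ((frakA_adm f).memB.mul (frakA_adm g).memB).2
    have hC := ((frakA_adm f).memC.mul (frakA_adm g).memC).2
    rw [← ext_mul] at hB hC
    refine max_le (hB.trans ?_) (hC.trans ?_)
    · exact mul_le_mul (le_max_left _ _) (le_max_left _ _) (normB_nonneg _) (normA_nonneg _)
    · exact mul_le_mul (le_max_right _ _) (le_max_right _ _) (normC_nonneg _ _) (normA_nonneg _)
  smul' c f := normA_smul c (frakA_adm f)
  eq_zero_of_map_eq_zero' f hf := by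
    ext z
    have := norm_apply_le_normA (frakA_adm f) z
    rw [hf] at this
    simpa using this

lemma frakNorm_apply {θ : ℕ → ℝ} (f : frakA θ) : frakNorm θ f = normA (f : C(K θ, ℂ)) := rfl

/-- The norm dominates the uniform norm on `K`, so one continuous function is the pointwise limit in
both `B` and `C`; the derivative condition is closed. -/
lemma frakNorm_complete (θ : ℕ → ℝ) (u : ℕ → frakA θ)
    (hu : ∀ ε : ℝ, 0 < ε → ∃ n₀ : ℕ, ∀ m ≥ n₀, ∀ n ≥ n₀, frakNorm θ (u m - u n) < ε) :
    ∃ f : frakA θ, Filter.Tendsto (fun n => frakNorm θ (u n - f)) Filter.atTop (𝓝 0) := by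
  have hc : CauchySeq fun n => (u n : C(K θ, ℂ)) := by
    rw [Metric.cauchySeq_iff]
    intro ε hε
    obtain ⟨n₀, h⟩ := hu ε hε
    refine ⟨n₀, fun m hm n hn => lt_of_le_of_lt ?_ (h m hm n hn)⟩
    rw [dist_eq_norm]
    exact (ContinuousMap.norm_le _ (normA_nonneg _)).2 (norm_apply_le_normA (frakA_adm (u m - u n)))
  obtain ⟨f, hf⟩ := cauchySeq_tendsto_of_complete hc
  have hlim : ∀ z ∈ K θ, Filter.Tendsto (fun n => ext (u n : C(K θ, ℂ)) z) Filter.atTop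
      (𝓝 (ext f z)) := by
    intro z hz
    simp only [ext_of_mem _ hz]
    exact ((continuous_eval_const (⟨z, hz⟩ : K θ)).tendsto f).comp hf
  have hsub : ∀ m n, ext ((u m - u n : frakA θ) : C(K θ, ℂ)) =
      ext (u m : C(K θ, ℂ)) - ext (u n : C(K θ, ℂ)) := fun m n => ext_sub _ _
  have hcB : ∀ ε > 0, ∃ n₀ : ℕ, ∀ m ≥ n₀, ∀ n ≥ n₀,
      normB (ext (u m : C(K θ, ℂ)) - ext (u n : C(K θ, ℂ))) ≤ ε := by
    intro ε hε
    obtain ⟨n₀, h⟩ := hu ε hε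
    refine ⟨n₀, fun m hm n hn => ?_⟩
    rw [← hsub]
    exact (le_max_left _ _).trans (h m hm n hn).le
  have hcC : ∀ ε > 0, ∃ n₀ : ℕ, ∀ m ≥ n₀, ∀ n ≥ n₀,
      normC θ (ext (u m : C(K θ, ℂ)) - ext (u n : C(K θ, ℂ))) ≤ ε := by
    intro ε hε
    obtain ⟨n₀, h⟩ := hu ε hε
    refine ⟨n₀, fun m hm n hn => ?_⟩
    rw [← hsub]
    exact (le_max_right _ _).trans (h m hm n hn).le
  obtain ⟨hB, hB'⟩ := memB_of_cauchy (fun n => (frakA_adm (u n)).memB) hcB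
    fun z hz => hlim z (disc_subset_K θ hz)
  obtain ⟨hC, hC'⟩ := memC_of_cauchy (fun n => (frakA_adm (u n)).memC) hcC
    fun z hz => hlim z (L_subset_K θ hz)
  have hA : Adm θ (ext f) := by
    refine ⟨hB, hC, hasBdryDeriv_of_limit hB hC fun ε hε => ?_⟩
    obtain ⟨n₁, h₁⟩ := hB' ε hε
    obtain ⟨n₂, h₂⟩ := hC' ε hε
    exact ⟨_, frakA_adm (u (max n₁ n₂)), h₁ _ (le_max_left _ _), h₂ _ (le_max_right _ _)⟩
  refine ⟨⟨f, mem_frakA.2 hA⟩, ?_⟩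
  rw [Metric.tendsto_atTop]
  intro ε hε
  obtain ⟨n₁, h₁⟩ := hB' (ε / 2) (half_pos hε)
  obtain ⟨n₂, h₂⟩ := hC' (ε / 2) (half_pos hε)
  refine ⟨max n₁ n₂, fun n hn => ?_⟩
  rw [Real.dist_eq, sub_zero, frakNorm_apply, abs_of_nonneg (normA_nonneg _)]
  have h3 : ext ((u n - ⟨f, mem_frakA.2 hA⟩ : frakA θ) : C(K θ, ℂ)) =
      ext (u n : C(K θ, ℂ)) - ext f := ext_sub _ _
  rw [normA, h3]
  refine (max_le (h₁ n ((le_max_left _ _).trans hn)) (h₂ n ((le_max_right _ _).trans hn))).trans_lt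
    (half_lt_self hε)

lemma frakNorm_one (θ : ℕ → ℝ) : frakNorm θ 1 = 1 := by
  have := normA_algebraMap (θ := θ) 1
  rwa [map_one, norm_one] at this

/-! ### Elements of `𝔄` -/

lemma Adm.continuousOn {θ : ℕ → ℝ} {h : ℂ → ℂ} (hh : Adm θ h) : ContinuousOn h (K θ) :=
  (hh.memB.1.continuousOn.union_of_isClosed hh.memC.continuousOn Metric.isClosed_closedBall
    (isClosed_L θ)).mono fun _ hz => mem_disc_or_mem_L hz

/-- The element of `𝔄` represented by a function on the plane. -/
def Adm.toFrakA {θ : ℕ → ℝ} {h : ℂ → ℂ} (hh : Adm θ h) : frakA θ :=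
  ⟨⟨fun z => h z, hh.continuousOn.domRestrict⟩,
    mem_frakA.2 (hh.congr fun z hz => by rw [ext_of_mem _ hz]; rfl)⟩

/-- Near the circle the boundary quotients are those of an ordinary complex derivative. At points of
`U` outside the ball only the Lipschitz condition matters, which is what admits poles there. -/
lemma adm_of_differentiableOn {θ : ℕ → ℝ} {ρ : ℝ} (hρ : 1 < ρ) {h : ℂ → ℂ}
    (hd : DifferentiableOn ℂ h (Metric.ball 0 ρ)) (hC : MemC θ h) : Adm θ h := by
  refine ⟨memB_of_differentiableOn hρ hd, hC, fun z₀ hz₀ x hx hlim => ?_⟩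
  have hz := circ_subset_disc hz₀
  have hda : DifferentiableAt ℂ h z₀ := hd.differentiableAt (Metric.isOpen_ball.mem_nhds
    (by rw [mem_ball_zero_iff, mem_circ.1 hz₀]; exact hρ))
  rw [hda.derivWithin (uniqueDiffOn_disc z₀ hz)]
  have hs := hasDerivAt_iff_tendsto_slope.1 hda.hasDerivAt
  have hx' : Filter.Tendsto x Filter.atTop (𝓝[≠] z₀) := by
    refine tendsto_nhdsWithin_iff.2 ⟨hlim, Filter.Eventually.of_forall fun n hn => ?_⟩
    have h1 := one_lt_norm_of_mem_U (hx n)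
    rw [hn, mem_circ.1 hz₀] at h1
    exact lt_irrefl _ h1
  refine (hs.comp hx').congr fun n => ?_
  rw [Function.comp_apply, slope_def_field]

lemma adm_id (θ : ℕ → ℝ) : Adm θ fun z => z :=
  adm_of_differentiableOn one_lt_two differentiableOn_id
    (memC_iff.2 ⟨1, zero_le_one, fun z _ w _ => by simp⟩)

/-- The coordinate function. -/
def coord (θ : ℕ → ℝ) : frakA θ := (adm_id θ).toFrakA

lemma coord_apply {θ : ℕ → ℝ} (z : K θ) : (coord θ : C(K θ, ℂ)) z = z := rfl

/-- With the convention `0⁻¹ = 0`, the function `(z - x)⁻¹` represents an element of `𝔄` also when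
`x` is a point of `U`. -/
lemma adm_inv_sub (θ : ℕ → ℝ) {x : ℂ} (hx : x ∉ disc) : Adm θ fun z => (z - x)⁻¹ := by
  rw [mem_disc, not_le] at hx
  refine adm_of_differentiableOn hx ?_ ?_
  · refine DifferentiableOn.inv (differentiableOn_id.sub_const x) fun z hz h0 => ?_
    rw [mem_ball_zero_iff] at hz
    rw [sub_eq_zero.1 h0] at hz
    exact lt_irrefl _ hz
  · obtain ⟨d, hd, h⟩ := exists_le_norm_sub θ (x := x) (by rwa [mem_disc, not_le])
    have key : ∀ z ∈ L θ, z ≠ x → ‖(z - x)⁻¹‖ ≤ d⁻¹ := fun z hz hzx => by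
      rw [norm_inv]
      exact inv_anti₀ hd (h z (L_subset_K θ hz) hzx)
    -- This covers the pairs containing `x`, where the function takes the default value `0`.
    have key' : ∀ z ∈ L θ, z ≠ x → ‖(z - x)⁻¹‖ ≤ d⁻¹ * d⁻¹ * ‖z - x‖ := fun z hz hzx => by
      have h1 := h z (L_subset_K θ hz) hzx
      calc ‖(z - x)⁻¹‖ ≤ d⁻¹ := key z hz hzx
        _ = d⁻¹ * d⁻¹ * d := by field_simp
        _ ≤ _ := by gcongr
    refine memC_iff.2 ⟨d⁻¹ * d⁻¹, by positivity, fun z hz w hw => ?_⟩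
    rcases eq_or_ne z x with rfl | hzx
    · rcases eq_or_ne w z with rfl | hwz
      · simp
      · rw [sub_self, inv_zero, zero_sub, norm_neg, norm_sub_rev z w]
        exact key' w hw hwz
    · rcases eq_or_ne w x with rfl | hwx
      · rw [sub_self, inv_zero, sub_zero]
        exact key' z hz hzx
      · rw [inv_sub_inv (sub_ne_zero.2 hzx) (sub_ne_zero.2 hwx), div_eq_mul_inv, mul_inv,
          norm_mul, norm_mul, sub_sub_sub_cancel_right, norm_sub_rev w z, mul_comm]
        gcongr
        · exact key z hz hzx
        · exact key w hw hwx

/-- Off the disc, the indicator function of a point is congruent to `1` modulo `z - x`. -/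
lemma exists_indicator (θ : ℕ → ℝ) {x : ℂ} (hx : x ∉ disc) :
    ∃ h e : frakA θ, e = 1 - (coord θ - algebraMap ℂ _ x) * h ∧
      ∀ z : K θ, (e : C(K θ, ℂ)) z = if (z : ℂ) = x then 1 else 0 := by
  refine ⟨(adm_inv_sub θ hx).toFrakA, _, rfl, fun z => ?_⟩
  have h1 : ((1 - (coord θ - algebraMap ℂ _ x) * (adm_inv_sub θ hx).toFrakA : frakA θ) :
      C(K θ, ℂ)) z = 1 - ((z : ℂ) - x) * ((z : ℂ) - x)⁻¹ := rfl
  -- At `z = x` the convention `0⁻¹ = 0` gives the value `1`. The point `x` need not lie in `K`; if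
  -- it does not, `e` is zero.
  rw [h1]
  split_ifs with hzx
  · simp [hzx]
  · rw [mul_inv_cancel₀ (sub_ne_zero.2 hzx), sub_self]

/-- Evaluation at a point of `K`. -/
noncomputable def evalAt {θ : ℕ → ℝ} (z : K θ) : frakA θ →ₐ[ℂ] ℂ :=
  (ContinuousMap.evalAlgHom ℂ ℂ z).comp (frakA θ).val

lemma evalAt_apply {θ : ℕ → ℝ} (z : K θ) (f : frakA θ) : evalAt z f = (f : C(K θ, ℂ)) z := rfl

lemma aeval_coord_apply {θ : ℕ → ℝ} (p : Polynomial ℂ) (z : K θ) :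
    (Polynomial.aeval (coord θ) p : C(K θ, ℂ)) z = p.eval (z : ℂ) := by
  have h := Polynomial.aeval_algHom_apply (evalAt z) (coord θ) p
  rw [evalAt_apply, evalAt_apply, coord_apply, Polynomial.coe_aeval_eq_eval] at h
  exact h.symm

/-- A polynomial that vanishes on the infinite set `U` is zero, so `ℂ[X]` embeds in `𝔄`. -/
lemma not_finiteDimensional_frakA (θ : ℕ → ℝ) : ¬ FiniteDimensional ℂ (frakA θ) := by
  intro hfin
  refine Polynomial.not_finite (R := ℂ) (Module.Finite.of_injective
    (Polynomial.aeval (coord θ)).toLinearMap ((injective_iff_map_eq_zero _).2 fun p hp => ?_))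
  refine Polynomial.eq_zero_of_infinite_isRoot p ((infinite_U θ).mono fun z hz => ?_)
  have h := aeval_coord_apply (θ := θ) p ⟨z, U_subset_K θ hz⟩
  rw [AlgHom.toLinearMap_apply] at hp
  rw [hp] at h
  exact h.symm

lemma maxIdealAt_eq_span {θ : ℕ → ℝ} {x : K θ} (hx : (x : ℂ) ∈ U θ) :
    ∃ g : frakA θ, maxIdealAt (frakA θ) x = Ideal.span {g} := by
  obtain ⟨h, e, -, he⟩ := exists_indicator θ (notMem_disc_of_mem_U hx)
  refine ⟨1 - e, le_antisymm (fun f hf => ?_) ?_⟩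
  · have hf0 : (f : C(K θ, ℂ)) x = 0 := hf
    refine Ideal.mem_span_singleton'.2 ⟨f, ?_⟩
    ext z
    have h1 : ((f * (1 - e) : frakA θ) : C(K θ, ℂ)) z =
      (f : C(K θ, ℂ)) z * (1 - (e : C(K θ, ℂ)) z) := rfl
    rw [h1, he]
    split_ifs with hzx
    · rw [Subtype.ext hzx, hf0, zero_mul]
    · rw [sub_zero, mul_one]
  · rw [Ideal.span_singleton_le_iff_mem]
    change 1 - (e : C(K θ, ℂ)) x = 0
    rw [he, if_pos rfl, sub_self]

/-! ### Characters -/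

/-- Characters of a Banach algebra are contractive. -/
lemma norm_character_le {R : Type*} [CommRing R] [Algebra ℂ R] (N : AlgebraNorm ℂ R)
    (h1 : N 1 = 1)
    (hc : ∀ u : ℕ → R, (∀ ε : ℝ, 0 < ε → ∃ n₀ : ℕ, ∀ m ≥ n₀, ∀ n ≥ n₀, N (u m - u n) < ε) →
      ∃ f : R, Filter.Tendsto (fun n => N (u n - f)) Filter.atTop (𝓝 0))
    (φ : R →ₐ[ℂ] ℂ) (f : R) : ‖φ f‖ ≤ N f := by
  let _ : NormedRing R := N.toRingNorm.toNormedRing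
  let _ : NormedAlgebra ℂ R := ⟨fun c g => (N.smul' c g).le⟩
  have : NormOneClass R := ⟨h1⟩
  have : CompleteSpace R := by
    refine Metric.complete_of_cauchySeq_tendsto fun u hu => ?_
    rw [Metric.cauchySeq_iff] at hu
    obtain ⟨g, hg⟩ := hc u fun ε hε => by
      obtain ⟨n₀, h⟩ := hu ε hε
      exact ⟨n₀, fun m hm n hn => by
        have := h m hm n hn
        rwa [dist_eq_norm] at this⟩
    exact ⟨g, tendsto_iff_norm_sub_tendsto_zero.2 hg⟩
  exact AlgHom.norm_apply_le_self φ f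

/-- By the product rule the Lipschitz constant of `f ^ n` is of order `n q ^ (n - 1)`. Multiplying
by `q` avoids the exponent `n - 1` at `n = 0`. -/
lemma normB_pow_le {θ : ℕ → ℝ} (f : frakA θ) {q : ℝ} (hq : 0 ≤ q)
    (hB : normB (ext (f : C(K θ, ℂ))) ≤ q) (hC : supC θ (ext (f : C(K θ, ℂ))) ≤ q) (n : ℕ) :
    normB (ext ((f ^ n : frakA θ) : C(K θ, ℂ))) ≤ q ^ n ∧
      supC θ (ext ((f ^ n : frakA θ) : C(K θ, ℂ))) ≤ q ^ n ∧
        lipC θ (ext ((f ^ n : frakA θ) : C(K θ, ℂ))) * q ≤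
          n * q ^ n * lipC θ (ext (f : C(K θ, ℂ))) := by
  induction n with
  | zero =>
    have h : Set.EqOn (ext ((f ^ 0 : frakA θ) : C(K θ, ℂ))) (fun _ => 1) (K θ) := fun z hz => by
      rw [ext_of_mem _ hz, pow_zero]
      rfl
    refine ⟨?_, supC_le fun z hz => ?_, ?_⟩
    · rw [normB_congr (h.mono (disc_subset_K θ)), (memB_const 1).2]
      simp
    · rw [h (L_subset_K θ hz)]
      simp
    · have := lipC_le (θ := θ) (h := ext ((f ^ 0 : frakA θ) : C(K θ, ℂ))) le_rfl
        fun z hz w hw => by rw [h (L_subset_K θ hz), h (L_subset_K θ hw)]; simp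
      rw [Nat.cast_zero, zero_mul, zero_mul]
      exact mul_nonpos_of_nonpos_of_nonneg this hq
  | succ n ih =>
    obtain ⟨h1, h2, h3⟩ := ih
    have hext : ext ((f ^ (n + 1) : frakA θ) : C(K θ, ℂ)) =
        ext ((f ^ n : frakA θ) : C(K θ, ℂ)) * ext (f : C(K θ, ℂ)) := by
      rw [pow_succ, ← ext_mul]
      rfl
    have hn := frakA_adm (f ^ n)
    have hf := frakA_adm f
    obtain ⟨-, h4, h5⟩ := hn.memC.mul_lipC_le hf.memC
    have h6 := lipC_nonneg θ (ext (f : C(K θ, ℂ)))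
    have h7 := lipC_nonneg θ (ext ((f ^ n : frakA θ) : C(K θ, ℂ)))
    have h8 := supC_nonneg θ (ext (f : C(K θ, ℂ)))
    rw [hext]
    refine ⟨?_, ?_, ?_⟩
    · rw [pow_succ]
      exact (hn.memB.mul hf.memB).2.trans (mul_le_mul h1 hB (normB_nonneg _) (by positivity))
    · rw [pow_succ]
      exact h4.trans (mul_le_mul h2 hC h8 (by positivity))
    · calc _ ≤ (supC θ (ext ((f ^ n : frakA θ) : C(K θ, ℂ))) * lipC θ (ext (f : C(K θ, ℂ))) +
            supC θ (ext (f : C(K θ, ℂ))) * lipC θ (ext ((f ^ n : frakA θ) : C(K θ, ℂ)))) * q := by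
            gcongr
        _ ≤ (q ^ n * lipC θ (ext (f : C(K θ, ℂ))) +
            q * lipC θ (ext ((f ^ n : frakA θ) : C(K θ, ℂ)))) * q := by gcongr
        _ = q ^ (n + 1) * lipC θ (ext (f : C(K θ, ℂ))) +
            q * (lipC θ (ext ((f ^ n : frakA θ) : C(K θ, ℂ))) * q) := by ring
        _ ≤ q ^ (n + 1) * lipC θ (ext (f : C(K θ, ℂ))) +
            q * (n * q ^ n * lipC θ (ext (f : C(K θ, ℂ)))) := by gcongr
        _ = _ := by push_cast; ring

lemma le_one_of_pow_le_linear {t c : ℝ} (h : ∀ n : ℕ, t ^ n ≤ 1 + n * c) : t ≤ 1 := by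
  by_contra! ht
  have h0 := tendsto_pow_const_div_const_pow_of_one_lt 0 ht
  have h1 := tendsto_pow_const_div_const_pow_of_one_lt 1 ht
  have h2 := h0.add (h1.mul_const c)
  rw [zero_mul, add_zero] at h2
  refine absurd (ge_of_tendsto' h2 (b := 1) fun n => ?_) (by norm_num)
  have hpos : 0 < t ^ n := by positivity
  have := h n
  rw [pow_zero, pow_one, div_mul_eq_mul_div, ← add_div, le_div_iff₀ hpos, one_mul]
  exact this

/-- The spectral radius of an element of `𝔄` in terms of its norms. -/
lemma norm_character_le_of_bounds {θ : ℕ → ℝ} (φ : frakA θ →ₐ[ℂ] ℂ) (f : frakA θ) {q : ℝ}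
    (hq : 0 < q) (hB : normB (ext (f : C(K θ, ℂ))) ≤ q)
    (hC : supC θ (ext (f : C(K θ, ℂ))) ≤ q) : ‖φ f‖ ≤ q := by
  rw [← div_le_one hq]
  refine le_one_of_pow_le_linear (c := lipC θ (ext (f : C(K θ, ℂ))) / q) fun n => ?_
  have h1 := norm_character_le (frakNorm θ) (frakNorm_one θ) (frakNorm_complete θ) φ (f ^ n)
  rw [map_pow, norm_pow, frakNorm_apply] at h1
  obtain ⟨hb, hs, hl⟩ := normB_pow_le f hq.le hB hC n
  have hl0 := lipC_nonneg θ (ext (f : C(K θ, ℂ)))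
  have hqn : 0 < q ^ n := by positivity
  rw [div_pow, div_le_iff₀ hqn]
  refine h1.trans (max_le ?_ ?_)
  · refine hb.trans (le_mul_of_one_le_left hqn.le ?_)
    have : 0 ≤ n * (lipC θ (ext (f : C(K θ, ℂ))) / q) := by positivity
    linarith
  · rw [normC_eq, add_mul, one_mul]
    refine add_le_add hs ?_
    rw [← le_div_iff₀ hq] at hl
    refine hl.trans (le_of_eq ?_)
    ring

/-- The points of `U` can be removed from the support without affecting the value of a character
that lives on the disc. -/
lemma exists_cutoff {θ : ℕ → ℝ} (φ : frakA θ →ₐ[ℂ] ℂ) (hφ : φ (coord θ) ∈ disc)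
    (t : Finset (K θ)) (ht : ∀ x ∈ t, (x : ℂ) ∈ U θ) :
    ∃ p : frakA θ, φ p = 1 ∧ (∀ z ∈ t, (p : C(K θ, ℂ)) z = 0) ∧
      ∀ z ∉ t, (p : C(K θ, ℂ)) z = 1 := by
  classical
  induction t using Finset.induction_on with
  | empty => exact ⟨1, map_one φ, by simp, fun _ _ => rfl⟩
  | insert x t hxt ih =>
    obtain ⟨p, hp, hp0, hp1⟩ := ih fun y hy => ht y (Finset.mem_insert_of_mem hy)
    have hxU := ht x (Finset.mem_insert_self x t)
    obtain ⟨h, e, -, he⟩ := exists_indicator θ (notMem_disc_of_mem_U hxU)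
    -- `(z - x) e = 0`, while `φ` sends `z - x` to a nonzero number because `φ(z)` is in the disc
    -- and `x` is not.
    have hφe : φ e = 0 := by
      have h0 : (coord θ - algebraMap ℂ (frakA θ) x) * e = 0 := by
        ext z
        have h1 : (((coord θ - algebraMap ℂ (frakA θ) x) * e : frakA θ) : C(K θ, ℂ)) z =
          ((z : ℂ) - x) * (e : C(K θ, ℂ)) z := rfl
        rw [h1, he]
        split_ifs with hzx
        · rw [hzx, sub_self, zero_mul]
          rfl
        · rw [mul_zero]
          rfl
      have h1 := congrArg φ h0
      rw [map_mul, map_sub, AlgHom.commutes, map_zero, Algebra.algebraMap_self_apply] at h1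
      refine (mul_eq_zero.1 h1).resolve_left fun h2 => ?_
      rw [sub_eq_zero.1 h2] at hφ
      exact notMem_disc_of_mem_U hxU hφ
    have happ : ∀ z : K θ, ((p * (1 - e) : frakA θ) : C(K θ, ℂ)) z =
      (p : C(K θ, ℂ)) z * (1 - (e : C(K θ, ℂ)) z) := fun z => rfl
    refine ⟨p * (1 - e), by rw [map_mul, map_sub, map_one, hφe, hp]; simp, fun z hz => ?_,
      fun z hz => ?_⟩
    · rw [happ, he]
      rcases Finset.mem_insert.1 hz with rfl | hz
      · simp
      · rw [hp0 z hz, zero_mul]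
    · rw [Finset.mem_insert, not_or] at hz
      rw [happ, he, hp1 z hz.2, if_neg fun h => hz.1 (Subtype.ext h)]
      simp

/-- For `q > normB f`, the set where `|f| ≥ q` is compact and consists of isolated points, so it is
finite. Cutting it off changes neither `φ f` nor `f` on the disc, and brings the uniform norm on `L`
down to `q`. -/
lemma norm_character_le_normB {θ : ℕ → ℝ} (φ : frakA θ →ₐ[ℂ] ℂ) (hφ : φ (coord θ) ∈ disc)
    (f : frakA θ) : ‖φ f‖ ≤ normB (ext (f : C(K θ, ℂ))) := by
  refine le_of_forall_gt_imp_ge_of_dense fun q hq => ?_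
  have hq0 : 0 < q := (normB_nonneg _).trans_lt hq
  have hfd : ∀ z : K θ, (z : ℂ) ∈ disc → ‖(f : C(K θ, ℂ)) z‖ < q := fun z hz => by
    rw [← ext_coe]
    exact ((frakA_adm f).memB.norm_le hz).trans_lt hq
  have hTU : ∀ z : K θ, q ≤ ‖(f : C(K θ, ℂ)) z‖ → (z : ℂ) ∈ U θ := fun z hz =>
    mem_U_of_notMem_disc z.2 fun hd => (hfd z hd).not_ge hz
  have hTc : IsCompact {z : K θ | q ≤ ‖(f : C(K θ, ℂ)) z‖} :=
    (isClosed_le continuous_const (f : C(K θ, ℂ)).continuous.norm).isCompact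
  obtain ⟨t, ht, hcov⟩ := hTc.elim_nhds_subcover (fun x => {x}) fun x hx =>
    ((isOpen_singleton_iff x).2 (hTU x hx)).mem_nhds rfl
  obtain ⟨p, hp, hp0, hp1⟩ := exists_cutoff φ hφ t fun x hx => hTU x (ht x hx)
  have hfp : φ (f * p) = φ f := by rw [map_mul, hp, mul_one]
  have happ : ∀ z : K θ, ((f * p : frakA θ) : C(K θ, ℂ)) z =
    (f : C(K θ, ℂ)) z * (p : C(K θ, ℂ)) z := fun z => rfl
  rw [← hfp]
  refine norm_character_le_of_bounds φ (f * p) hq0 ?_ (supC_le fun z hz => ?_)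
  · rw [normB_congr (h := ext (f : C(K θ, ℂ)))]
    · exact hq.le
    · intro z hz
      have hzK := disc_subset_K θ hz
      rw [ext_of_mem _ hzK, ext_of_mem _ hzK, happ, hp1, mul_one]
      intro hzt
      exact notMem_disc_of_mem_U (hTU _ (ht _ hzt)) hz
  · rw [ext_of_mem _ (L_subset_K θ hz), happ]
    set y : K θ := ⟨z, L_subset_K θ hz⟩
    by_cases hy : y ∈ t
    · rw [hp0 y hy, mul_zero, norm_zero]
      exact hq0.le
    · rw [hp1 y hy, mul_one]
      by_contra! hlt
      have := hcov (show y ∈ {z : K θ | q ≤ ‖(f : C(K θ, ℂ)) z‖} from hlt.le)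
      simp only [Set.mem_iUnion, Set.mem_singleton_iff] at this
      obtain ⟨x, hx, rfl⟩ := this
      exact hy hx

lemma isNatural_frakA (θ : ℕ → ℝ) : IsNatural (frakA θ) := by
  intro φ
  set l := φ (coord θ) with hl
  by_cases hd : l ∈ disc
  · refine ⟨⟨l, disc_subset_K θ hd⟩, fun f => ?_⟩
    refine eq_of_forall_dist_le fun ε hε => ?_
    obtain ⟨p, hp⟩ := exists_polynomial_normB_sub_lt (frakA_adm f).memB (half_pos hε)
    have hext : Set.EqOn (ext ((f - Polynomial.aeval (coord θ) p : frakA θ) : C(K θ, ℂ)))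
        (ext (f : C(K θ, ℂ)) - fun z => p.eval z) disc := by
      intro z hz
      have hzK := disc_subset_K θ hz
      rw [ext_of_mem _ hzK, Pi.sub_apply, ext_of_mem _ hzK,
        ← aeval_coord_apply (θ := θ) p ⟨z, hzK⟩]
      rfl
    have h1 := norm_character_le_normB φ hd (f - Polynomial.aeval (coord θ) p)
    rw [normB_congr hext, map_sub, ← Polynomial.aeval_algHom_apply, ← hl,
      Polynomial.coe_aeval_eq_eval] at h1
    have h2 := ((frakA_adm f).memB.sub (memB_polynomial p)).1.norm_le hd
    rw [Pi.sub_apply, ext_of_mem _ (disc_subset_K θ hd)] at h2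
    rw [dist_eq_norm]
    calc _ = ‖(φ f - p.eval l) - ((f : C(K θ, ℂ)) ⟨l, disc_subset_K θ hd⟩ - p.eval l)‖ := by
          ring_nf
      _ ≤ _ := norm_sub_le _ _
      _ ≤ ε := by linarith
  · obtain ⟨h, e, hdef, he⟩ := exists_indicator θ hd
    have hφe : φ e = 1 := by
      rw [hdef, map_sub, map_mul, map_sub, AlgHom.commutes, ← hl]
      simp
    -- Otherwise `z - l` would be invertible in `𝔄`, that is `e = 0`, against `φ e = 1`.
    have hlK : l ∈ K θ := by
      by_contra hlK
      have h0 : e = 0 := by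
        ext z
        rw [he, if_neg fun (h : (z : ℂ) = l) => hlK (h ▸ z.2)]
        rfl
      rw [h0, map_zero] at hφe
      exact zero_ne_one hφe
    refine ⟨⟨l, hlK⟩, fun f => ?_⟩
    have hfe : f * e = algebraMap ℂ (frakA θ) ((f : C(K θ, ℂ)) ⟨l, hlK⟩) * e := by
      ext z
      have h1 : ((f * e : frakA θ) : C(K θ, ℂ)) z =
        (f : C(K θ, ℂ)) z * (e : C(K θ, ℂ)) z := rfl
      have h2 : ((algebraMap ℂ (frakA θ) ((f : C(K θ, ℂ)) ⟨l, hlK⟩) * e : frakA θ) :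
        C(K θ, ℂ)) z = (f : C(K θ, ℂ)) ⟨l, hlK⟩ * (e : C(K θ, ℂ)) z := rfl
      rw [h1, h2, he]
      split_ifs with hz
      · congr 2
        exact Subtype.ext hz
      · rw [mul_zero, mul_zero]
    have := congrArg φ hfe
    rwa [map_mul, map_mul, hφe, AlgHom.commutes, mul_one, mul_one] at this

lemma isBanachFunctionAlgebra_frakA (θ : ℕ → ℝ) :
    IsBanachFunctionAlgebra (frakA θ) (frakNorm θ) where
  compactSpace := inferInstance
  t2Space := inferInstance
  nonempty := ⟨⟨0, disc_subset_K θ (by simp [mem_disc])⟩⟩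
  separatesPoints x y hxy := ⟨coord θ, (coord θ).2, fun h => hxy (Subtype.ext h)⟩
  norm_one := frakNorm_one θ
  complete := frakNorm_complete θ

/-! ### The boundary derivative of a self-map of the disc -/

lemma sq_norm_one_sub_conj_mul (a w : ℂ) :
    ‖1 - (starRingEnd ℂ) a * w‖ ^ 2 - ‖w - a‖ ^ 2 = (1 - ‖a‖ ^ 2) * (1 - ‖w‖ ^ 2) := by
  simp only [← Complex.normSq_eq_norm_sq, Complex.normSq_apply, Complex.sub_re, Complex.sub_im,
    Complex.mul_re, Complex.mul_im, Complex.conj_re, Complex.conj_im, Complex.one_re,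
    Complex.one_im]
  ring

/-- A consequence of the Schwarz–Pick lemma. -/
lemma one_sub_sq_norm_ge {g : ℂ → ℂ} (hd : DifferentiableOn ℂ g (Metric.ball 0 1))
    (hm : Set.MapsTo g (Metric.ball 0 1) (Metric.ball 0 1)) {z : ℂ} (hz : ‖z‖ < 1) :
    (1 - ‖z‖ ^ 2) * (1 - ‖g 0‖) ^ 2 ≤ 1 - ‖g z‖ ^ 2 := by
  set a := g 0 with ha
  have ha1 : ‖a‖ < 1 := mem_ball_zero_iff.1 (hm (Metric.mem_ball_self one_pos))
  have hlow : ∀ w : ℂ, ‖w‖ < 1 → 1 - ‖a‖ ≤ ‖1 - (starRingEnd ℂ) a * w‖ := by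
    intro w hw
    have h1 := norm_sub_norm_le (1 : ℂ) ((starRingEnd ℂ) a * w)
    rw [norm_one, norm_mul, RCLike.norm_conj] at h1
    have h2 : ‖a‖ * ‖w‖ ≤ ‖a‖ := mul_le_of_le_one_right (norm_nonneg a) hw.le
    linarith
  have hne : ∀ w : ℂ, ‖w‖ < 1 → 1 - (starRingEnd ℂ) a * w ≠ 0 := fun w hw h0 => by
    have := hlow w hw
    rw [h0, norm_zero] at this
    linarith
  have hgz : ‖g z‖ < 1 := mem_ball_zero_iff.1 (hm (mem_ball_zero_iff.2 hz))
  -- Schwarz's lemma for `g` followed by the automorphism of the disc that sends `g 0` to `0`.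
  have hschwarz := Complex.norm_le_norm_of_mapsTo_ball (R := 1) (z := z)
    (f := fun w => (g w - a) / (1 - (starRingEnd ℂ) a * g w))
    ((hd.sub_const a).div ((hd.const_mul _).const_sub 1) fun w hw =>
      hne _ (mem_ball_zero_iff.1 (hm hw)))
    (fun w hw => by
      have hgw : ‖g w‖ < 1 := mem_ball_zero_iff.1 (hm hw)
      rw [mem_closedBall_zero_iff, norm_div, div_le_one (norm_pos_iff.2 (hne _ hgw))]
      refine (sq_le_sq₀ (norm_nonneg _) (norm_nonneg _)).1 ?_
      have h1 := sq_norm_one_sub_conj_mul a (g w)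
      have h2 : 0 ≤ (1 - ‖a‖ ^ 2) * (1 - ‖g w‖ ^ 2) := by
        apply mul_nonneg <;> nlinarith [norm_nonneg a, norm_nonneg (g w)]
      linarith) (by simp [ha]) hz
  rw [norm_div, div_le_iff₀ (norm_pos_iff.2 (hne _ hgz))] at hschwarz
  have h1 := sq_norm_one_sub_conj_mul a (g z)
  have h2 : ‖g z - a‖ ^ 2 ≤ ‖z‖ ^ 2 * ‖1 - (starRingEnd ℂ) a * g z‖ ^ 2 := by
    rw [← mul_pow]
    gcongr
  have h3 : (1 - ‖a‖) ^ 2 ≤ ‖1 - (starRingEnd ℂ) a * g z‖ ^ 2 :=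
    pow_le_pow_left₀ (by linarith) (hlow _ hgz) 2
  have h4 : 0 ≤ 1 - ‖z‖ ^ 2 := by nlinarith [norm_nonneg z]
  have h5 : 0 ≤ 1 - ‖g z‖ ^ 2 := by nlinarith [norm_nonneg (g z)]
  nlinarith [mul_le_mul_of_nonneg_left h3 h4, mul_nonneg (sq_nonneg ‖a‖) h5]

/-- Hopf's lemma at the point `1`. -/
lemma exists_pos_deriv_eq {g : ℂ → ℂ} {g' : ℂ} (hd : DifferentiableOn ℂ g (Metric.ball 0 1))
    (hm : Set.MapsTo g (Metric.ball 0 1) (Metric.ball 0 1)) (hle : ∀ w ∈ disc, ‖g w‖ ≤ 1)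
    (h1 : g 1 = 1) (hg' : HasDerivWithinAt g g' disc 1) : ∃ c : ℝ, 0 < c ∧ g' = c := by
  have ha1 : ‖g 0‖ < 1 := mem_ball_zero_iff.1 (hm (Metric.mem_ball_self one_pos))
  refine ⟨g'.re, ?_, Complex.ext rfl ?_⟩
  -- Radial approach: Schwarz–Pick keeps the real parts of the difference quotients above `(1 - ‖g
  -- 0‖) ^ 2 / 2`.
  · set t : ℕ → ℝ := fun n => 1 - 1 / ((n : ℝ) + 1) with ht
    have ht0 : ∀ n, 0 ≤ t n := fun n => by
      have hn : (0 : ℝ) ≤ n := Nat.cast_nonneg n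
      rw [ht, sub_nonneg, div_le_one (by positivity)]
      linarith
    have ht1 : ∀ n, t n < 1 := fun n => by
      have : 0 < 1 / ((n : ℝ) + 1) := by positivity
      simp only [ht]
      linarith
    have htlim : Filter.Tendsto t Filter.atTop (𝓝 1) := by
      rw [← sub_zero (1 : ℝ)]
      exact tendsto_one_div_add_atTop_nhds_zero_nat.const_sub 1
    have hnorm : ∀ n, ‖(t n : ℂ)‖ = t n := fun n => by
      rw [Complex.norm_real, Real.norm_of_nonneg (ht0 n)]
    have hlim : Filter.Tendsto (fun n => (t n : ℂ)) Filter.atTop (𝓝[disc \ {1}] 1) := by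
      refine tendsto_nhdsWithin_iff.2 ⟨?_, Filter.Eventually.of_forall fun n => ⟨?_, ?_⟩⟩
      · exact (Complex.continuous_ofReal.tendsto' 1 1 Complex.ofReal_one).comp htlim
      · rw [mem_disc, hnorm]
        exact (ht1 n).le
      · intro h
        exact (ht1 n).ne (Complex.ofReal_eq_one.1 h)
    have hs := (Complex.continuous_re.tendsto _).comp
      ((hasDerivWithinAt_iff_tendsto_slope.1 hg').comp hlim)
    have hc : 0 < (1 - ‖g 0‖) ^ 2 / 2 := by
      have : 0 < 1 - ‖g 0‖ := by linarith
      positivity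
    refine lt_of_lt_of_le hc (ge_of_tendsto' hs fun n => ?_)
    have hsl : slope g 1 (t n) = ((1 - g (t n)) / ((1 - t n : ℝ) : ℂ)) := by
      rw [slope_def_field, h1]
      push_cast
      rw [← neg_sub (1 : ℂ) (g _), ← neg_sub (1 : ℂ) (t n : ℂ), neg_div_neg_eq]
    rw [Function.comp_apply, Function.comp_apply, hsl, Complex.div_ofReal_re,
      le_div_iff₀ (by linarith [ht1 n]), Complex.sub_re, Complex.one_re]
    have hp := one_sub_sq_norm_ge hd hm (z := t n) (by rw [hnorm]; exact ht1 n)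
    rw [hnorm] at hp
    have hre := Complex.re_le_norm (g (t n))
    have hgt := hle (t n) (by rw [mem_disc, hnorm]; exact (ht1 n).le)
    have h3 : 1 - ‖g (t n)‖ ^ 2 ≤ 2 * (1 - ‖g (t n)‖) := by nlinarith [sq_nonneg (1 - ‖g (t n)‖)]
    have h4 : (1 - t n) * (1 - ‖g 0‖) ^ 2 ≤ (1 - t n ^ 2) * (1 - ‖g 0‖) ^ 2 := by
      gcongr
      nlinarith [ht0 n, ht1 n]
    linarith
  -- Tangential direction: `Re g` has a maximum along the circle at `1`, so the real part of `i g'`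
  -- vanishes.
  · have hexp : HasDerivAt (fun s : ℝ => Complex.exp (s * Complex.I)) Complex.I 0 := by
      have h2 : HasDerivAt (fun s : ℝ => (s : ℂ) * Complex.I) Complex.I 0 := by
        simpa using (Complex.ofRealCLM.hasDerivAt (x := (0 : ℝ))).mul_const Complex.I
      simpa using h2.cexp
    have hcomp := hg'.scomp_hasDerivAt_of_eq 0 hexp
      (fun s => by rw [mem_disc, Complex.norm_exp_ofReal_mul_I]) (by simp)
    have hre := Complex.reCLM.hasFDerivAt.comp_hasDerivAt (0 : ℝ) hcomp
    have hmax : IsLocalMax (Complex.reCLM ∘ g ∘ fun s : ℝ => Complex.exp (s * Complex.I)) 0 := by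
      refine Filter.Eventually.of_forall fun s => ?_
      have h3 : ‖g (Complex.exp (s * Complex.I))‖ ≤ 1 :=
        hle _ (by rw [mem_disc, Complex.norm_exp_ofReal_mul_I])
      simpa [h1] using (Complex.re_le_norm _).trans h3
    have := hmax.hasDerivAt_eq_zero hre
    simpa using this

/-- Hopf's lemma. -/
lemma exists_pos_mul_deriv_div_eq {g : ℂ → ℂ} {g' z : ℂ}
    (hd : DifferentiableOn ℂ g (Metric.ball 0 1))
    (hm : Set.MapsTo g (Metric.ball 0 1) (Metric.ball 0 1)) (hle : ∀ w ∈ disc, ‖g w‖ ≤ 1)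
    (hz : z ∈ circ) (hgz : ‖g z‖ = 1) (hg' : HasDerivWithinAt g g' disc z) :
    ∃ c : ℝ, 0 < c ∧ z * g' / g z = c := by
  have hz1 := mem_circ.1 hz
  have hgz0 : g z ≠ 0 := by
    rw [← norm_ne_zero_iff, hgz]
    exact one_ne_zero
  have hnorm : ∀ w : ℂ, ‖z * w‖ = ‖w‖ := fun w => by rw [norm_mul, hz1, one_mul]
  have hnorm' : ∀ w : ℂ, ‖g (z * w) / g z‖ = ‖g (z * w)‖ := fun w => by
    rw [norm_div, hgz, div_one]
  have hball : Set.MapsTo (fun w => z * w) (Metric.ball 0 1) (Metric.ball 0 1) := fun w hw => by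
    rw [mem_ball_zero_iff] at *
    rwa [hnorm]
  have hdisc : Set.MapsTo (fun w => z * w) disc disc := fun w hw => by
    rw [mem_disc] at *
    rwa [hnorm]
  -- Rotations in the source and in the target reduce to the fixed point `1`.
  refine exists_pos_deriv_eq (g := fun w => g (z * w) / g z)
    ((hd.comp (differentiableOn_id.const_mul z) hball).div_const _) (fun w hw => ?_)
    (fun w hw => ?_) ?_ ?_
  · rw [mem_ball_zero_iff, hnorm', ← mem_ball_zero_iff]
    exact hm (hball hw)
  · rw [hnorm']
    exact hle _ (hdisc hw)
  · rw [mul_one, div_self hgz0]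
  · have hlin : HasDerivWithinAt (fun w => z * w) z disc 1 := by
      simpa using (hasDerivWithinAt_id (1 : ℂ) disc).const_mul z
    have := (hg'.comp_of_eq 1 hlin hdisc (mul_one z).symm).div_const (g z)
    rwa [mul_comm g' z] at this

/-! ### Strong boundary points -/

/-- If the modulus of an element of `𝔄` attains its maximum over `K` at a point of the disc, then
it is constant on the disc. -/
lemma norm_eq_one_on_disc {θ : ℕ → ℝ} {h : ℂ → ℂ} (hh : Adm θ h) (hle : ∀ w ∈ K θ, ‖h w‖ ≤ 1)
    {z : ℂ} (hz : z ∈ disc) (hz1 : ‖h z‖ = 1) : ∀ w ∈ disc, ‖h w‖ = 1 := by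
  have hled : ∀ w ∈ disc, ‖h w‖ ≤ 1 := fun w hw => hle w (disc_subset_K θ hw)
  have hcl : closure (Metric.ball (0 : ℂ) 1) = disc := closure_ball _ one_ne_zero
  have hd : DifferentiableOn ℂ h disc := hh.memB.1.differentiableOn (by simp)
  by_cases hint : ∃ w ∈ Metric.ball (0 : ℂ) 1, ‖h w‖ = 1
  · obtain ⟨w, hw, hw1⟩ := hint
    have hmax : IsMaxOn (norm ∘ h) (Metric.ball 0 1) w := fun y hy => by
      rw [Set.mem_ofPred_eq, Function.comp_apply, Function.comp_apply, hw1]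
      exact hled y (Metric.ball_subset_closedBall hy)
    have heq := Complex.norm_eqOn_closure_of_isPreconnected_of_isMaxOn
      (convex_ball (0 : ℂ) 1).isPreconnected Metric.isOpen_ball
      (by rw [← hcl] at hd; exact hd.diffContOnCl) hw hmax
    intro y hy
    rw [← hcl] at hy
    exact (heq hy).trans hw1
  · exfalso
    push Not at hint
    have hm : Set.MapsTo h (Metric.ball 0 1) (Metric.ball 0 1) := fun w hw =>
      mem_ball_zero_iff.2 (lt_of_le_of_ne (hled w (Metric.ball_subset_closedBall hw)) (hint w hw))
    have hzc : z ∈ circ := by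
      rw [mem_circ]
      refine le_antisymm (mem_disc.1 hz) ?_
      by_contra! hlt
      exact hint z (mem_ball_zero_iff.2 hlt) hz1
    obtain ⟨c, hc, hcd⟩ := exists_pos_mul_deriv_div_eq (hd.mono Metric.ball_subset_closedBall) hm
      hled hzc hz1 (hh.memB.differentiableWithinAt hz).hasDerivWithinAt
    obtain ⟨x, hxU, hxlim, ⟨C, hC⟩, hxre⟩ := exists_seq_approach θ hzc
    have hz0 : z ≠ 0 := by
      rintro rfl
      simp [mem_circ] at hzc
    have hhz0 : h z ≠ 0 := by
      rw [← norm_ne_zero_iff, hz1]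
      exact one_ne_zero
    have hxz : ∀ n, x n - z ≠ 0 := fun n h0 => by
      have h1 := one_lt_norm_of_mem_U (hxU n)
      rw [sub_eq_zero.1 h0, mem_circ.1 hzc] at h1
      exact lt_irrefl _ h1
    -- Normalised so that `p n → c` and `h (x n) / h z = 1 + p n * (x n / z - 1)`, whose real part
    -- is `1 + c/(n+1) + o(1/n)`.
    set p : ℕ → ℂ := fun n => z * ((h (x n) - h z) / (x n - z)) / h z with hp
    have hplim : Filter.Tendsto (fun n => p n - c) Filter.atTop (𝓝 0) := by
      have := (((hh.bdry z hzc x hxU hxlim).const_mul z).div_const (h z)).sub_const (c : ℂ)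
      rwa [hcd, sub_self] at this
    have hfx : ∀ n, h (x n) / h z = 1 + p n * (x n / z - 1) := fun n => by
      have := hxz n
      simp only [hp]
      field_simp
      ring
    have herr : Filter.Tendsto (fun n : ℕ => ((p n - c) * (((n : ℝ) + 1 : ℝ) * (x n / z - 1))).re)
        Filter.atTop (𝓝 0) := by
      have h2 : Filter.Tendsto (fun n : ℕ => (p n - c) * (((n : ℝ) + 1 : ℝ) * (x n / z - 1)))
          Filter.atTop (𝓝 0) := by
        refine squeeze_zero_norm (a := fun n => ‖p n - c‖ * C) (fun n => ?_) ?_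
        · have hn : (0 : ℝ) ≤ (n : ℝ) + 1 := by positivity
          rw [norm_mul, norm_mul, Complex.norm_real, Real.norm_of_nonneg hn]
          gcongr
          exact hC n
        · simpa using hplim.norm.mul_const C
      exact (Complex.continuous_re.tendsto' 0 0 Complex.zero_re).comp h2
    have hsum := (hxre.const_mul c).add herr
    rw [mul_one, add_zero] at hsum
    -- Since `|h| ≤ 1` on `U`, the rescaled real parts are nonpositive, yet they tend to `c > 0`.
    refine absurd (le_of_tendsto' hsum (b := 0) fun n => ?_) (not_le.2 hc)
    have hn : (0 : ℝ) ≤ (n : ℝ) + 1 := by positivity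
    have hre : (h (x n) / h z).re ≤ 1 := by
      refine (Complex.re_le_norm _).trans ?_
      rw [norm_div, hz1, div_one]
      exact hle _ (U_subset_K θ (hxU n))
    rw [hfx n, Complex.add_re, Complex.one_re] at hre
    have hid : c * (((n : ℝ) + 1) * (x n / z - 1).re) +
        ((p n - c) * (((n : ℝ) + 1 : ℝ) * (x n / z - 1))).re =
          ((n : ℝ) + 1) * (p n * (x n / z - 1)).re := by
      rw [← Complex.re_ofReal_mul, ← Complex.re_ofReal_mul, ← Complex.re_ofReal_mul,
        ← Complex.add_re]
      congr 1
      ring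
    rw [hid]
    exact mul_nonpos_of_nonneg_of_nonpos hn (by linarith)

lemma disc_subset_of_isPeakSet {θ : ℕ → ℝ} {F : Set (K θ)} (hF : IsPeakSet (frakA θ) F)
    {z : K θ} (hz : (z : ℂ) ∈ disc) (hzF : z ∈ F) : ∀ w : K θ, (w : ℂ) ∈ disc → w ∈ F := by
  obtain ⟨-, f, hf, hf1, hlt⟩ := hF
  intro w hw
  by_contra hwF
  have hle : ∀ y ∈ K θ, ‖ext f y‖ ≤ 1 := fun y hy => by
    rw [ext_of_mem f hy]
    by_cases hyF : (⟨y, hy⟩ : K θ) ∈ F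
    · exact (hf1 _ hyF).le
    · exact (hlt _ hyF).le
  have h1 := norm_eq_one_on_disc (mem_frakA.1 hf) hle hz (by rw [ext_coe]; exact hf1 z hzF) w hw
  rw [ext_coe] at h1
  exact (hlt w hwF).ne h1

/-- An intersection of peak sets that contains a point of the disc contains the whole disc, so it is
not a singleton. At points of `U` the indicator peaks. -/
lemma strongBoundary_frakA (θ : ℕ → ℝ) :
    strongBoundary (frakA θ) = {x : K θ | (x : ℂ) ∈ U θ} := by
  ext x
  constructor
  · rintro ⟨𝓕, h𝓕, hx⟩
    refine mem_U_of_notMem_disc x.2 fun hd => ?_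
    have hxF : ∀ F ∈ 𝓕, x ∈ F := fun F hF => by
      have : x ∈ ⋂₀ 𝓕 := by rw [hx]; rfl
      exact this F hF
    have hall : ∀ w : K θ, (w : ℂ) ∈ disc → w = x := fun w hw => by
      have : w ∈ ⋂₀ 𝓕 := fun F hF => disc_subset_of_isPeakSet (h𝓕 F hF) hd (hxF F hF) w hw
      rw [hx] at this
      exact this
    have h0 : (0 : ℂ) ∈ disc := by simp [mem_disc]
    have h1 : (1 : ℂ) ∈ disc := by simp [mem_disc]
    have := (hall ⟨0, disc_subset_K θ h0⟩ h0).trans (hall ⟨1, disc_subset_K θ h1⟩ h1).symm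
    exact zero_ne_one (congrArg Subtype.val this)
  · intro hx
    obtain ⟨h, e, -, he⟩ := exists_indicator θ (notMem_disc_of_mem_U hx)
    refine ⟨{{x}}, ?_, Set.sInter_singleton _⟩
    rintro F rfl
    refine ⟨isClosed_singleton, e, e.2, ?_, fun y hy => ?_⟩
    · rintro y rfl
      rw [he, if_pos rfl, norm_one]
    · rw [he, if_neg fun h => hy (Subtype.ext h), norm_zero]
      exact one_pos

end BFA

theorem mainTheorem11 :
    (∀ θ : ℕ → ℝ,
      IsCompact (BFA.K θ) ∧
      (BFA.U θ).Countable ∧ (BFA.U θ).Infinite ∧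
      {x : BFA.K θ | IsOpen ({x} : Set (BFA.K θ))} = {x : BFA.K θ | (x : ℂ) ∈ BFA.U θ} ∧
      closure (BFA.U θ) = BFA.L θ ∧
      ∃ (𝔄 : Subalgebra ℂ C(BFA.K θ, ℂ)) (N : AlgebraNorm ℂ 𝔄),
        (∀ f : C(BFA.K θ, ℂ), f ∈ 𝔄 ↔ BFA.MemFrakA f) ∧
        (∀ f : 𝔄, N f = BFA.normA (f : C(BFA.K θ, ℂ))) ∧
        BFA.IsBanachFunctionAlgebra 𝔄 N ∧
        BFA.IsNatural 𝔄 ∧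
        ¬ FiniteDimensional ℂ 𝔄 ∧
        BFA.strongBoundary 𝔄 = {x : BFA.K θ | (x : ℂ) ∈ BFA.U θ} ∧
        ∀ x ∈ BFA.strongBoundary 𝔄, ∃ g : 𝔄, BFA.maxIdealAt 𝔄 x = Ideal.span {g}) ∧
    ¬ ∀ (X : Type) [TopologicalSpace X] (A : Subalgebra ℂ C(X, ℂ)) (N : AlgebraNorm ℂ A),
        BFA.IsBanachFunctionAlgebra A N → BFA.IsNatural A →
        (BFA.strongBoundary A).Countable →
        (∀ x ∈ BFA.strongBoundary A,
          ∃ S : Set A, S.Countable ∧ BFA.maxIdealAt A x = Ideal.span S) →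
        FiniteDimensional ℂ A := by
  have hideal : ∀ θ : ℕ → ℝ, ∀ x ∈ BFA.strongBoundary (BFA.frakA θ),
      ∃ g : BFA.frakA θ, BFA.maxIdealAt (BFA.frakA θ) x = Ideal.span {g} := fun θ x hx => by
    rw [BFA.strongBoundary_frakA] at hx
    exact BFA.maxIdealAt_eq_span hx
  refine ⟨fun θ => ⟨BFA.isCompact_K θ, BFA.countable_U θ, BFA.infinite_U θ,
    Set.ext fun x => BFA.isOpen_singleton_iff x, BFA.closure_U θ, BFA.frakA θ, BFA.frakNorm θ,
    fun f => Iff.rfl, fun f => rfl, BFA.isBanachFunctionAlgebra_frakA θ, BFA.isNatural_frakA θ,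
    BFA.not_finiteDimensional_frakA θ, BFA.strongBoundary_frakA θ, hideal θ⟩, fun H => ?_⟩
  refine BFA.not_finiteDimensional_frakA 0 (H (BFA.K 0) (BFA.frakA 0) (BFA.frakNorm 0)
    (BFA.isBanachFunctionAlgebra_frakA 0) (BFA.isNatural_frakA 0) ?_ fun x hx => ?_)
  · rw [BFA.strongBoundary_frakA]
    exact (BFA.countable_U 0).preimage Subtype.val_injective
  · obtain ⟨g, hg⟩ := hideal 0 x hx
    exact ⟨{g}, Set.countable_singleton g, hg⟩
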